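/- Let $n\ge 0$, $s\ge 1$, and let $M$ be a $(2n+s)$-dimensional smooth manifold with a framed $\varphi$-structure $(\varphi,\xi_\alpha,\eta^\alpha,g)$, $\alpha=1,\dots,s$: $g$ is a Riemannian metric, $\varphi$ a $(1,1)$-tensor field, $\xi_\alpha$ vector fields and $\eta^\alpha$ 1-forms with $$\varphi^2X=-X+\sum_{\alpha=1}^s\eta^\alpha(X)\xi_\alpha,\quad \eta^\alpha(\xi_\beta)=\delta^\alpha_\beta,\quad \varphi\xi_\alpha=0,\quad \eta^\alpha(\varphi X)=0,\quad \eta^\alpha(X)=g(X,\xi_\alpha),$$ $$g(\varphi X,\varphi Y)=g(X,Y)-\sum_{\alpha=1}^s\eta^\alpha(X)\eta^\alpha(Y).$$ Put $\Omega(X,Y)=g(X,\varphi Y)$, and assume that $M$ is a $C$-manifold: the Nijenhuis tensor of $\varphi$ satisfies $N_\varphi(X,Y)=-2\sum_\alpha d\eta^\alpha(X,Y)\,\xi_\alpha$, and $d\Omega=0$, $d\eta^\alpha=0$ for all $\alpha$. Let $\nabla$ be the Levi-Civita connection of $g$, let $q\neq 0$ be real and let $F_q=q\,\Omega$. A smooth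 curve $\gamma:I\to M$, where $I$ is a nondegenerate interval, with unit tangent $T=\gamma'$ is a normal magnetic curve for $F_q$ if $\nabla_TT=\Phi_qT$, where $\Phi_q$ is defined by $g(\Phi_qX,Y)=F_q(X,Y)$ (that is, $\Phi_q=-q\varphi$). It is slant with contact angle $\theta$ if $\eta^\alpha(T)=\cos\theta$ along $\gamma$ for all $\alpha$, with $\theta$ constant, and Legendre if $\eta^\alpha(T)=0$ for all $\alpha$. A geodesic has $\nabla_TT=0$. A circle with curvature $\kappa_1$ and frame $\{T,v_2\}$ is a unit-speed curve for which $\kappa_1>0$ is constant, the smooth fields $T,v_2$ along it are orthonormal, $\nabla_TT=\kappa_1v_2$ and $\nabla_Tv_2=-\kappa_1T$. A helix with curvatures $\kappa_1,\kappa_2$ and frame $\{T,v_2,v_3\}$ is a unit-speed curve for which $\kappa_1,\kappa_2>0$ are constants, the smooth fields $T,v_2,v_3$ along it are orthonormal, $\nabla_TT=\kappa_1v_2$, $\nabla_Tv_2=-\kappa_1T+\kappa_2v_3$ and $\nabla_Tv_3=-\kappa_2v_2$. Let $\gamma:I\to M$ be a unit-speed slant curve with contact angle $\theta$. Then $\gamma$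 is a normal magnetic curve for $F_q$ if and only if one of the following holds: (i) $\gamma$ is a geodesic and is an integral curve of $\frac{1}{\sqrt s}\sum_{\alpha=1}^s\xi_\alpha$ or of $-\frac{1}{\sqrt s}\sum_{\alpha=1}^s\xi_\alpha$; (ii) $\gamma$ is a Legendre circle with $\kappa_1=|q|$ and Frenet frame $\{T,\,-\operatorname{sgn}(q)\,\varphi T\}$; (iii) $\gamma$ is a non-Legendre helix with $\kappa_1=|q|\sqrt{1-s\cos^2\theta}$, $\kappa_2=|q|\sqrt s\,\varepsilon\cos\theta$ and Frenet frame $$\left\{T,\ \frac{-\operatorname{sgn}(q)}{\sqrt{1-s\cos^2\theta}}\,\varphi T,\ \frac{\varepsilon}{\sqrt s\,\sqrt{1-s\cos^2\theta}}\Big(\sum_{\alpha=1}^s\xi_\alpha-s\cos\theta\,T\Big)\right\},$$ where $\theta\neq\frac{\pi}{2}$, $|\cos\theta|<\frac1{\sqrt s}$ and $\varepsilon=\operatorname{sgn}(\cos\theta)$. -/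

import Mathlib

open scoped Manifold ContDiff Bundle Topology

noncomputable section

namespace CMagnetic

/-! ### Tensor calculus on a smooth manifold -/

section Calculus

variable {d : ℕ} {M : Type*} [TopologicalSpace M]
  [ChartedSpace (EuclideanSpace ℝ (Fin d)) M] [IsManifold (𝓡 d) ∞ M]

/-- `X` is a smooth vector field on the set `U`. -/
def IsSmoothFieldOn (X : ∀ p : M, TangentSpace (𝓡 d) p) (U : Set M) : Prop :=
  ContMDiffOn (𝓡 d) (𝓡 d).tangent ∞ (fun p : M => (⟨p, X p⟩ : TangentBundle (𝓡 d) M)) U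

/-- The derivative `X f` of a function in the direction of a vector field, at the point `p`. -/
def dirDeriv (X : ∀ p : M, TangentSpace (𝓡 d) p) (f : M → ℝ) (p : M) : ℝ :=
  mfderiv (𝓡 d) 𝓘(ℝ, ℝ) f p (X p)

/-- The exterior derivative of a 1-form (with the factor `1/2` customary in contact geometry):
`2 dη(X, Y) = X (η Y) - Y (η X) - η [X, Y]`. -/
def dOne (η : ∀ p : M, TangentSpace (𝓡 d) p →L[ℝ] ℝ)
    (X Y : ∀ p : M, TangentSpace (𝓡 d) p) (p : M) : ℝ :=
  (1 / 2) * (dirDeriv X (fun x => η x (Y x)) p - dirDeriv Y (fun x => η x (X x)) p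
    - η p (VectorField.mlieBracket (𝓡 d) X Y p))

/-- The exterior derivative of a 2-form (with the factor `1/3` of the same convention). -/
def dTwo (F : ∀ p : M, TangentSpace (𝓡 d) p →L[ℝ] TangentSpace (𝓡 d) p →L[ℝ] ℝ)
    (X Y Z : ∀ p : M, TangentSpace (𝓡 d) p) (p : M) : ℝ :=
  (1 / 3) * (dirDeriv X (fun x => F x (Y x) (Z x)) p
    + dirDeriv Y (fun x => F x (Z x) (X x)) p
    + dirDeriv Z (fun x => F x (X x) (Y x)) p
    - F p (VectorField.mlieBracket (𝓡 d) X Y p) (Z p)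
    - F p (VectorField.mlieBracket (𝓡 d) Y Z p) (X p)
    - F p (VectorField.mlieBracket (𝓡 d) Z X p) (Y p))

/-- The Nijenhuis tensor
`N_φ(X, Y) = φ² [X, Y] + [φ X, φ Y] - φ [φ X, Y] - φ [X, φ Y]` of a (1,1)-tensor field. -/
def nijenhuis (φ : ∀ p : M, TangentSpace (𝓡 d) p →L[ℝ] TangentSpace (𝓡 d) p)
    (X Y : ∀ p : M, TangentSpace (𝓡 d) p) (p : M) : TangentSpace (𝓡 d) p :=
  φ p (φ p (VectorField.mlieBracket (𝓡 d) X Y p))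
    + VectorField.mlieBracket (𝓡 d) (fun x => φ x (X x)) (fun x => φ x (Y x)) p
    - φ p (VectorField.mlieBracket (𝓡 d) (fun x => φ x (X x)) Y p)
    - φ p (VectorField.mlieBracket (𝓡 d) X (fun x => φ x (Y x)) p)

end Calculus

/-! ### Curves in a Riemannian manifold -/

section Riemannian

variable {d : ℕ} {M : Type*} [TopologicalSpace M]
  [ChartedSpace (EuclideanSpace ℝ (Fin d)) M] [IsManifold (𝓡 d) ∞ M]

/-- The metric `g` in the coordinates given by the chart around `p`: the pullback of `g` under the
inverse of that chart. -/
def coordMetric (g : Bundle.ContMDiffRiemannianMetric (𝓡 d) ∞ (EuclideanSpace ℝ (Fin d))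
      (fun p : M => TangentSpace (𝓡 d) p)) (p : M) (y : EuclideanSpace ℝ (Fin d)) :
    EuclideanSpace ℝ (Fin d) →L[ℝ] EuclideanSpace ℝ (Fin d) →L[ℝ] ℝ :=
  let A : EuclideanSpace ℝ (Fin d) →L[ℝ]
      TangentSpace (𝓡 d) ((extChartAt (𝓡 d) p).symm y) :=
    mfderiv 𝓘(ℝ, EuclideanSpace ℝ (Fin d)) (𝓡 d) (extChartAt (𝓡 d) p).symm y
  (ContinuousLinearMap.precomp ℝ A).comp ((g.inner ((extChartAt (𝓡 d) p).symm y)).comp A)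

/-- Christoffel symbols of the first kind in the chart around `p`:
`w ↦ (1/2) (∂_u g (v, w) + ∂_v g (u, w) - ∂_w g (u, v))`. -/
def christoffelFirst (g : Bundle.ContMDiffRiemannianMetric (𝓡 d) ∞ (EuclideanSpace ℝ (Fin d))
      (fun p : M => TangentSpace (𝓡 d) p)) (p : M) (y u v : EuclideanSpace ℝ (Fin d)) :
    EuclideanSpace ℝ (Fin d) →L[ℝ] ℝ :=
  let D := fderiv ℝ (coordMetric g p) y
  (1 / 2 : ℝ) • (D u v + D v u - (D.flip u).flip v)

/-- Christoffel symbols `Γ(u, v)` of the Levi-Civita connection of `g` in the chart around `p`.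
The coordinate metric is invertible at every point `y` of the target of the chart, and there
`g(Γ(u, v), w)` is the Christoffel symbol of the first kind. -/
def christoffel (g : Bundle.ContMDiffRiemannianMetric (𝓡 d) ∞ (EuclideanSpace ℝ (Fin d))
      (fun p : M => TangentSpace (𝓡 d) p)) (p : M) (y u v : EuclideanSpace ℝ (Fin d)) :
    EuclideanSpace ℝ (Fin d) :=
  (coordMetric g p y).inverse (christoffelFirst g p y u v)

/-- The velocity `T = γ'` of a curve defined on the interval `J`. -/
def velocity (γ : ℝ → M) (J : Set ℝ) (t : ℝ) : TangentSpace (𝓡 d) (γ t) :=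
  mfderivWithin 𝓘(ℝ, ℝ) (𝓡 d) γ J t (1 : ℝ)

/-- `V` is a smooth vector field along the curve `γ : J → M`. -/
def IsSmoothAlong (γ : ℝ → M) (J : Set ℝ) (V : ∀ t : ℝ, TangentSpace (𝓡 d) (γ t)) : Prop :=
  ContMDiffOn 𝓘(ℝ, ℝ) (𝓡 d).tangent ∞ (fun t : ℝ => (⟨γ t, V t⟩ : TangentBundle (𝓡 d) M)) J

/-- The coordinate expression, in the chart around `p`, of a vector field along `γ`. -/
def coordField (γ : ℝ → M) (V : ∀ t : ℝ, TangentSpace (𝓡 d) (γ t)) (p : M) (t : ℝ) :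
    EuclideanSpace ℝ (Fin d) :=
  mfderiv (𝓡 d) 𝓘(ℝ, EuclideanSpace ℝ (Fin d)) (extChartAt (𝓡 d) p) (γ t) (V t)

/-- The Levi-Civita covariant derivative `∇_T V` of a vector field `V` along `γ : J → M`, at the
parameter `t`. In local coordinates it is `dV/dt + Γ(γ', V)`; the coordinates used here
are those of the preferred chart around `γ t`. -/
def covDerivAlong (g : Bundle.ContMDiffRiemannianMetric (𝓡 d) ∞ (EuclideanSpace ℝ (Fin d))
      (fun p : M => TangentSpace (𝓡 d) p)) (γ : ℝ → M) (J : Set ℝ)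
    (V : ∀ t : ℝ, TangentSpace (𝓡 d) (γ t)) (t : ℝ) : TangentSpace (𝓡 d) (γ t) :=
  (mfderiv (𝓡 d) 𝓘(ℝ, EuclideanSpace ℝ (Fin d)) (extChartAt (𝓡 d) (γ t)) (γ t)).inverse
    (derivWithin (coordField γ V (γ t)) J t
      + christoffel g (γ t) (extChartAt (𝓡 d) (γ t) (γ t))
          (coordField γ (velocity γ J) (γ t) t) (coordField γ V (γ t) t))

/-- `γ : J → M` is a smooth unit-speed curve, `J` being a nondegenerate interval. -/
structure IsUnitSpeedCurve
    (g : Bundle.ContMDiffRiemannianMetric (𝓡 d) ∞ (EuclideanSpace ℝ (Fin d))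
      (fun p : M => TangentSpace (𝓡 d) p)) (γ : ℝ → M) (J : Set ℝ) : Prop where
  ordConnected : J.OrdConnected
  nontrivial : J.Nontrivial
  smooth : ContMDiffOn 𝓘(ℝ, ℝ) (𝓡 d) ∞ γ J
  unit : ∀ t ∈ J, g.inner (γ t) (velocity γ J t) (velocity γ J t) = 1

/-- The unit-speed curve `γ` is a Frenet curve of osculating order `m + 1` with Frenet frame
`v 0 = T, v 1, …, v m` and curvatures `κ 0, …, κ (m - 1)`. (Usually the frame is
numbered `T = v₁, …, v_r` and the curvatures `κ₁, …, κ_{r-1}`, with `r = m + 1`.) The Frenet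
equations read `∇_T v_i = - κ_{i-1} v_{i-1} + κ_i v_{i+1}`, a term being absent where
its index is out of range. -/
structure IsFrenetFrame
    (g : Bundle.ContMDiffRiemannianMetric (𝓡 d) ∞ (EuclideanSpace ℝ (Fin d))
      (fun p : M => TangentSpace (𝓡 d) p)) (γ : ℝ → M) (J : Set ℝ) (m : ℕ)
    (v : Fin (m + 1) → ∀ t : ℝ, TangentSpace (𝓡 d) (γ t)) (κ : Fin m → ℝ → ℝ) : Prop where
  tangent : ∀ t ∈ J, v 0 t = velocity γ J t
  smooth : ∀ i, IsSmoothAlong γ J (v i)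
  orthonormal : ∀ t ∈ J, ∀ i j, g.inner (γ t) (v i t) (v j t) = if i = j then 1 else 0
  curvature_pos : ∀ i, ∀ t ∈ J, 0 < κ i t
  frenet : ∀ t ∈ J, ∀ i, covDerivAlong g γ J (v i) t =
    (∑ j : Fin m, if j.castSucc = i then κ j t • v j.succ t else 0)
      - ∑ j : Fin m, if j.succ = i then κ j t • v j.castSucc t else 0

/-- A geodesic: `∇_T T = 0`. -/
def IsGeodesic (g : Bundle.ContMDiffRiemannianMetric (𝓡 d) ∞ (EuclideanSpace ℝ (Fin d))
      (fun p : M => TangentSpace (𝓡 d) p)) (γ : ℝ → M) (J : Set ℝ) : Prop :=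
  ∀ t ∈ J, covDerivAlong g γ J (velocity γ J) t = 0

/-- A circle: Frenet curve of order 2 with constant curvature `κ₁ > 0` and frame `{T, v₂}`. -/
def IsCircle (g : Bundle.ContMDiffRiemannianMetric (𝓡 d) ∞ (EuclideanSpace ℝ (Fin d))
      (fun p : M => TangentSpace (𝓡 d) p)) (γ : ℝ → M) (J : Set ℝ) (κ₁ : ℝ)
    (v₂ : ∀ t : ℝ, TangentSpace (𝓡 d) (γ t)) : Prop :=
  IsFrenetFrame g γ J 1 ![velocity γ J, v₂] ![fun _ => κ₁]

/-- A helix: Frenet curve of order 3 with constant curvatures `κ₁, κ₂ > 0` and frame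
`{T, v₂, v₃}`. -/
def IsHelix (g : Bundle.ContMDiffRiemannianMetric (𝓡 d) ∞ (EuclideanSpace ℝ (Fin d))
      (fun p : M => TangentSpace (𝓡 d) p)) (γ : ℝ → M) (J : Set ℝ) (κ₁ κ₂ : ℝ)
    (v₂ v₃ : ∀ t : ℝ, TangentSpace (𝓡 d) (γ t)) : Prop :=
  IsFrenetFrame g γ J 2 ![velocity γ J, v₂, v₃] ![fun _ => κ₁, fun _ => κ₂]

/-- `Φ` is the Lorentz force of the 2-form `F`: `g(Φ X, Y) = F(X, Y)`. -/
def IsLorentzForce (g : Bundle.ContMDiffRiemannianMetric (𝓡 d) ∞ (EuclideanSpace ℝ (Fin d))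
      (fun p : M => TangentSpace (𝓡 d) p))
    (F : ∀ p : M, TangentSpace (𝓡 d) p →L[ℝ] TangentSpace (𝓡 d) p →L[ℝ] ℝ)
    (Φ : ∀ p : M, TangentSpace (𝓡 d) p →L[ℝ] TangentSpace (𝓡 d) p) : Prop :=
  ∀ p : M, ∀ X Y : TangentSpace (𝓡 d) p, g.inner p (Φ p X) Y = F p X Y

/-- `γ : J → M` is a normal magnetic curve of `F`: it has unit speed and satisfies the Lorentz
equation `∇_T T = Φ T`, `Φ` being the Lorentz force of `F`. -/
def IsNormalMagneticCurve
    (g : Bundle.ContMDiffRiemannianMetric (𝓡 d) ∞ (EuclideanSpace ℝ (Fin d))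
      (fun p : M => TangentSpace (𝓡 d) p))
    (F : ∀ p : M, TangentSpace (𝓡 d) p →L[ℝ] TangentSpace (𝓡 d) p →L[ℝ] ℝ)
    (γ : ℝ → M) (J : Set ℝ) : Prop :=
  IsUnitSpeedCurve g γ J ∧
    ∃ Φ : ∀ p : M, TangentSpace (𝓡 d) p →L[ℝ] TangentSpace (𝓡 d) p,
      IsLorentzForce g F Φ ∧
        ∀ t ∈ J, covDerivAlong g γ J (velocity γ J) t = Φ (γ t) (velocity γ J t)

end Riemannian

/-! ### Framed φ-manifolds and C-manifolds -/

/-- A framed φ-structure `(φ, ξ_α, η^α, g)`, `α = 1, …, s`, on a manifold `M` of dimension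
`2 n + s`. -/
structure FramedStructure (n s : ℕ) (M : Type*) [TopologicalSpace M]
    [ChartedSpace (EuclideanSpace ℝ (Fin (2 * n + s))) M]
    [IsManifold (𝓡 (2 * n + s)) ∞ M] where
  /-- the Riemannian metric -/
  g : Bundle.ContMDiffRiemannianMetric (𝓡 (2 * n + s)) ∞ (EuclideanSpace ℝ (Fin (2 * n + s)))
    (fun p : M => TangentSpace (𝓡 (2 * n + s)) p)
  /-- the (1,1)-tensor field -/
  φ : ∀ p : M, TangentSpace (𝓡 (2 * n + s)) p →L[ℝ] TangentSpace (𝓡 (2 * n + s)) p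
  /-- the vector fields -/
  ξ : Fin s → ∀ p : M, TangentSpace (𝓡 (2 * n + s)) p
  /-- the 1-forms -/
  η : Fin s → ∀ p : M, TangentSpace (𝓡 (2 * n + s)) p →L[ℝ] ℝ
  φ_smooth : ContMDiff (𝓡 (2 * n + s))
    ((𝓡 (2 * n + s)).prod 𝓘(ℝ, EuclideanSpace ℝ (Fin (2 * n + s)) →L[ℝ]
      EuclideanSpace ℝ (Fin (2 * n + s)))) ∞
    (fun p : M => Bundle.TotalSpace.mk' (EuclideanSpace ℝ (Fin (2 * n + s)) →L[ℝ]
      EuclideanSpace ℝ (Fin (2 * n + s)))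
      (E := fun p : M => TangentSpace (𝓡 (2 * n + s)) p →L[ℝ] TangentSpace (𝓡 (2 * n + s)) p)
      p (φ p))
  ξ_smooth : ∀ α, IsSmoothFieldOn (ξ α) Set.univ
  η_smooth : ∀ α, ContMDiff (𝓡 (2 * n + s))
    ((𝓡 (2 * n + s)).prod 𝓘(ℝ, EuclideanSpace ℝ (Fin (2 * n + s)) →L[ℝ] ℝ)) ∞
    (fun p : M => Bundle.TotalSpace.mk' (EuclideanSpace ℝ (Fin (2 * n + s)) →L[ℝ] ℝ)
      (E := fun p : M => TangentSpace (𝓡 (2 * n + s)) p →L[ℝ] Bundle.Trivial M ℝ p)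
      p (η α p))
  φ_sq : ∀ p (X : TangentSpace (𝓡 (2 * n + s)) p), φ p (φ p X) = -X + ∑ α, η α p X • ξ α p
  η_ξ : ∀ p α β, η α p (ξ β p) = if α = β then 1 else 0
  φ_ξ : ∀ p α, φ p (ξ α p) = 0
  η_φ : ∀ p α (X : TangentSpace (𝓡 (2 * n + s)) p), η α p (φ p X) = 0
  η_eq : ∀ p α (X : TangentSpace (𝓡 (2 * n + s)) p), η α p X = g.inner p X (ξ α p)
  g_φ : ∀ p (X Y : TangentSpace (𝓡 (2 * n + s)) p),
    g.inner p (φ p X) (φ p Y) = g.inner p X Y - ∑ α, η α p X * η α p Y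

namespace FramedStructure

variable {n s : ℕ} {M : Type*} [TopologicalSpace M]
  [ChartedSpace (EuclideanSpace ℝ (Fin (2 * n + s))) M] [IsManifold (𝓡 (2 * n + s)) ∞ M]

/-- The fundamental 2-form `Ω(X, Y) = g(X, φ Y)`. -/
def fundForm (S : FramedStructure n s M) (p : M) :
    TangentSpace (𝓡 (2 * n + s)) p →L[ℝ] TangentSpace (𝓡 (2 * n + s)) p →L[ℝ] ℝ :=
  (ContinuousLinearMap.precomp ℝ (S.φ p)).comp (S.g.inner p)

/-- A C-manifold: the framed structure is normal, `N_φ = -2 ∑ dη^α ⊗ ξ_α`, and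
`dΩ = 0`, `dη^α = 0`. All of these are conditions on tensors, tested on local smooth
vector fields. -/
structure IsCManifold (S : FramedStructure n s M) : Prop where
  normal : ∀ U : Set M, IsOpen U → ∀ X Y : (∀ p : M, TangentSpace (𝓡 (2 * n + s)) p),
    IsSmoothFieldOn X U → IsSmoothFieldOn Y U → ∀ p ∈ U,
      nijenhuis S.φ X Y p = (-2 : ℝ) • ∑ α, dOne (S.η α) X Y p • S.ξ α p
  dΩ_eq_zero : ∀ U : Set M, IsOpen U → ∀ X Y Z : (∀ p : M, TangentSpace (𝓡 (2 * n + s)) p),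
    IsSmoothFieldOn X U → IsSmoothFieldOn Y U → IsSmoothFieldOn Z U → ∀ p ∈ U,
      dTwo S.fundForm X Y Z p = 0
  dη_eq_zero : ∀ α, ∀ U : Set M, IsOpen U →
    ∀ X Y : (∀ p : M, TangentSpace (𝓡 (2 * n + s)) p),
    IsSmoothFieldOn X U → IsSmoothFieldOn Y U → ∀ p ∈ U, dOne (S.η α) X Y p = 0

/-- The contact magnetic field of strength `q`: `F_q = q Ω`, which is closed on a C-manifold. -/
def magneticField (S : FramedStructure n s M) (q : ℝ) (p : M) :
    TangentSpace (𝓡 (2 * n + s)) p →L[ℝ] TangentSpace (𝓡 (2 * n + s)) p →L[ℝ] ℝ :=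
  q • S.fundForm p

/-- `γ` is slant with contact angle `θ`: `η^α(T) = cos θ` for all `α`. -/
def IsSlant (S : FramedStructure n s M) (γ : ℝ → M) (J : Set ℝ) (θ : ℝ) : Prop :=
  ∀ α, ∀ t ∈ J, S.η α (γ t) (velocity γ J t) = Real.cos θ

/-- A Legendre curve: `η^α(T) = 0` for all `α`. -/
def IsLegendre (S : FramedStructure n s M) (γ : ℝ → M) (J : Set ℝ) : Prop :=
  ∀ α, ∀ t ∈ J, S.η α (γ t) (velocity γ J t) = 0

end FramedStructure

end CMagnetic

end

/-!
The heart of the matter is that on a C-manifold `∇φ = 0` and `∇ξ_α = 0`. Granted this, everything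
is algebra along the curve. The Lorentz force of `q Ω` is `-q φ`, so a magnetic curve satisfies
`∇_T T = -q φ T`; differentiating `φ T` gives `∇_T (φ T) = -q φ² T = q (T - cos θ ∑ ξ_α)`, and
`∇_T (∑ ξ_α - s cos θ T) = s q cos θ φ T`, so `T`, `φ T` and `∑ ξ_α - s cos θ T` close up under
`∇_T`. Their norms are governed by `|φ T|² = 1 - s cos² θ`: if this vanishes, `T` is `cos θ ∑ ξ_α`
and the curve is a geodesic; otherwise normalizing gives the frame of a circle (`cos θ = 0`) or a
helix. Conversely, the first Frenet equation of each of the three cases is the Lorentz equation.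

The connection is defined in coordinates, and at the parameter `t` in the chart around `γ t`, so
parallelism is needed only at the centre of a chart. There constant coordinate fields commute, and
the conditions on `dη^α`, `dΩ` and the Nijenhuis tensor become identities between the first
derivatives of the coordinate expressions (`FramedStructure.IsCManifold.localCStructure`). With the
Christoffel symbols added they become tensor identities for `A = ∇φ` and `B_α = ∇ξ_α`
(`LocalCStructure.pointwise`), and the vanishing of `A` and `B` is linear algebra:
symmetry of `B_α` and the Nijenhuis and `dΩ` identities with `ξ_α` inserted give `B_α = 0`
(`PointwiseCStructure.B_eq_zero`), after which the argument for Kähler manifolds gives `A = 0`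
(`PointwiseCStructure.A_eq_zero`).
-/

noncomputable section

namespace CMagnetic

/-! ### Linear algebra of parallelism at a point -/

section Pointwise

variable {V : Type*} [AddCommGroup V] [Module ℝ V] {s : ℕ}

/-- The pointwise algebraic data of a framed `φ`-structure (metric `g`, endomorphism `φ`, vectors
`ξ α`; the covectors are `g · (ξ α)`) together with candidates `A` for `∇φ` and `B α` for `∇ξ_α`
that satisfy the identities forced by differentiating the structure equations
and by `dΩ = 0`, `dη^α = 0` and `N_φ = 0`. -/
structure PointwiseCStructure (g : V →ₗ[ℝ] V →ₗ[ℝ] ℝ) (φ : V →ₗ[ℝ] V) (ξ : Fin s → V)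
    (A : V →ₗ[ℝ] V →ₗ[ℝ] V) (B : Fin s → V →ₗ[ℝ] V) : Prop where
  symm : ∀ u v, g u v = g v u
  nondeg : ∀ v, (∀ w, g v w = 0) → v = 0
  sq : ∀ v, φ (φ v) = -v + ∑ α, g v (ξ α) • ξ α
  φ_ξ : ∀ α, φ (ξ α) = 0
  g_φ_ξ : ∀ α v, g (φ v) (ξ α) = 0
  skew : ∀ v w, g (φ v) w = -g v (φ w)
  A_skew : ∀ x y z, g (A x y) z = -g (A x z) y
  A_cyclic : ∀ x y z, g (A x y) z + g (A y z) x + g (A z x) y = 0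
  nijenhuis : ∀ x y, A (φ x) y - A (φ y) x - φ (A x y) + φ (A y x) = 0
  B_symm : ∀ α x y, g (B α x) y = g (B α y) x
  A_ξ : ∀ α x, A x (ξ α) = -φ (B α x)
  B_skew : ∀ α β x, g (B α x) (ξ β) = -g (B β x) (ξ α)
  A_sq : ∀ x y, A x (φ y) + φ (A x y) = ∑ α, (g (B α x) y • ξ α + g y (ξ α) • B α x)

namespace PointwiseCStructure

variable {g : V →ₗ[ℝ] V →ₗ[ℝ] ℝ} {φ : V →ₗ[ℝ] V} {ξ : Fin s → V}
  {A : V →ₗ[ℝ] V →ₗ[ℝ] V} {B : Fin s → V →ₗ[ℝ] V}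

/-- The range of `φ` and the vectors `ξ α` span the space. -/
lemma functional_eq_zero (h : PointwiseCStructure g φ ξ A B) (f : V →ₗ[ℝ] ℝ)
    (hφ : ∀ v, f (φ v) = 0) (hξ : ∀ α, f (ξ α) = 0) (v : V) : f v = 0 := by
  have h1 := congrArg f (h.sq v)
  simp only [map_add, map_neg, map_sum, map_smul, hφ, hξ, smul_zero, Finset.sum_const_zero,
    add_zero] at h1
  linarith

lemma g_nijenhuis (h : PointwiseCStructure g φ ξ A B) (x y z : V) :
    g (A (φ x) y) z - g (A (φ y) x) z + g (A x y) (φ z) - g (A y x) (φ z) = 0 := by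
  have h1 := congrArg (fun w => g w z) (h.nijenhuis x y)
  simp only [map_add, map_sub, LinearMap.add_apply, LinearMap.sub_apply, h.skew, map_zero,
    LinearMap.zero_apply] at h1
  linarith

lemma g_A_ξ (h : PointwiseCStructure g φ ξ A B) (α : Fin s) (x z : V) :
    g (A x (ξ α)) z = g (B α x) (φ z) := by
  rw [h.A_ξ, map_neg, LinearMap.neg_apply, h.skew, neg_neg]

lemma φ_cube (h : PointwiseCStructure g φ ξ A B) (v : V) : φ (φ (φ v)) = -φ v := by
  rw [h.sq (φ v)]
  simp [h.g_φ_ξ]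

lemma B_φ_φ (h : PointwiseCStructure g φ ξ A B) (α : Fin s) (x z : V) :
    g (B α (φ x)) (φ z) = 0 := by
  have h1 := h.g_nijenhuis x (ξ α) z
  have h2 := h.A_cyclic (ξ α) x (φ z)
  rw [h.φ_ξ, map_zero, LinearMap.zero_apply, map_zero, LinearMap.zero_apply, h.g_A_ξ,
    h.g_A_ξ] at h1
  rw [h.A_skew x (φ z) (ξ α), h.g_A_ξ, h.g_A_ξ, h.B_symm α (φ z) (φ x)] at h2
  linarith

/-- Symmetric in one pair of indices and antisymmetric in another, the components of `B` along
the `ξ α` vanish. -/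
lemma B_ξ_ξ (h : PointwiseCStructure g φ ξ A B) (α β γ : Fin s) :
    g (B α (ξ γ)) (ξ β) = 0 := by
  have h1 := h.B_symm α (ξ γ) (ξ β)
  have h2 := h.B_skew α γ (ξ β)
  have h3 := h.B_symm γ (ξ β) (ξ α)
  have h4 := h.B_skew γ β (ξ α)
  have h5 := h.B_symm β (ξ α) (ξ γ)
  have h6 := h.B_skew β α (ξ γ)
  linarith

lemma B_φ_ξ (h : PointwiseCStructure g φ ξ A B) (α β : Fin s) (x : V) :
    g (B α (φ x)) (ξ β) = 0 := by
  have h1 := h.g_nijenhuis (ξ α) (ξ β) (φ x)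
  rw [h.φ_ξ, h.φ_ξ, map_zero, LinearMap.zero_apply, LinearMap.zero_apply, map_zero,
    LinearMap.zero_apply, h.g_A_ξ, h.g_A_ξ, h.φ_cube, map_neg, map_neg] at h1
  have h2 := h.B_skew α β (φ x)
  have h3 := h.B_symm β (φ x) (ξ α)
  have h4 := h.B_symm α (φ x) (ξ β)
  linarith

/-- The pointwise form of `∇ξ_α = 0`. -/
lemma B_eq_zero (h : PointwiseCStructure g φ ξ A B) (α : Fin s) (x : V) : B α x = 0 := by
  refine h.nondeg _ fun y => ?_
  refine h.functional_eq_zero (g (B α x)) (fun v => ?_) (fun β => ?_) y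
  · rw [h.B_symm]
    refine h.functional_eq_zero (g (B α (φ v))) (fun w => h.B_φ_φ α v w)
      (fun β => h.B_φ_ξ α β v) x
  · rw [h.B_symm]
    refine h.functional_eq_zero (g (B α (ξ β))) (fun w => ?_) (fun γ => h.B_ξ_ξ α γ β) x
    rw [h.B_symm]
    exact h.B_φ_ξ α β w

/-- The pointwise form of `∇φ = 0`: once `B = 0` this is the classical argument
for Kähler manifolds. -/
lemma A_eq_zero (h : PointwiseCStructure g φ ξ A B) (x y : V) : A x y = 0 := by
  have hξ : ∀ α u, A u (ξ α) = 0 := fun α u => by rw [h.A_ξ, h.B_eq_zero, map_zero, neg_zero]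
  have hcomm : ∀ u v w, g (A u (φ v)) w = g (A u v) (φ w) := by
    intro u v w
    have h1 := h.A_sq u v
    simp only [h.B_eq_zero, map_zero, LinearMap.zero_apply, zero_smul, smul_zero, add_zero,
      Finset.sum_const_zero] at h1
    rw [eq_neg_of_add_eq_zero_left h1, map_neg, LinearMap.neg_apply, h.skew, neg_neg]
  -- the relation `P + Q - R = 0` for `P = g (A (φ u) v) w` and its cyclic permutations `Q`, `R`
  have hpqr : ∀ u v w, g (A (φ u) v) w + g (A (φ v) w) u - g (A (φ w) u) v = 0 := by
    intro u v w
    have h1 := h.g_nijenhuis u v w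
    have h2 := h.A_cyclic u v (φ w)
    have h3 := h.A_skew v (φ w) u
    have h4 := h.A_skew (φ v) u w
    linarith
  have hφ : ∀ u v w, g (A (φ u) v) w = 0 := by
    intro u v w
    have h1 := hpqr u v w
    have h2 := hpqr v w u
    have h3 := hpqr w u v
    linarith
  have hξ' : ∀ α v w, g (A (ξ α) v) w = 0 := by
    intro α v w
    refine h.functional_eq_zero (g (A (ξ α) v)) (fun z => ?_) (fun β => ?_) w
    · have h1 := h.A_cyclic (ξ α) v (φ z)
      rw [h.A_skew v, hξ, hξ] at h1
      simpa using h1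
    · rw [h.A_skew, hξ]
      simp
  refine h.nondeg _ fun z => ?_
  refine h.functional_eq_zero ((LinearMap.flip g z) ∘ₗ (A.flip y)) (fun v => ?_) (fun α => ?_) x
  · exact hφ v y z
  · exact hξ' α y z

end PointwiseCStructure

end Pointwise

/-! ### Parallelism of the structure tensors in coordinates -/

section Local

variable {E : Type*} [NormedAddCommGroup E] [NormedSpace ℝ E] {s : ℕ}

/-- `Γ` is the Christoffel symbol of the second kind at `x` of the metric `G`. -/
def IsChristoffel (G : E → E →L[ℝ] E →L[ℝ] ℝ) (x : E) (Γ : E → E → E) : Prop :=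
  ∀ u v w, G x (Γ u v) w =
    (1 / 2) * (fderiv ℝ G x u v w + fderiv ℝ G x v u w - fderiv ℝ G x w u v)

/-- A metric `G`, an endomorphism field `P` and vector fields `Z α` near the point `x` of a vector
space that form a C-structure: the algebraic identities hold near `x`, and `dη^α = 0`, `dΩ = 0`,
`N_P = 0` hold at `x`, evaluated on constant vector fields. -/
structure LocalCStructure (G : E → E →L[ℝ] E →L[ℝ] ℝ) (P : E → E →L[ℝ] E)
    (Z : Fin s → E → E) (x : E) : Prop where
  diff_G : DifferentiableAt ℝ G x
  diff_P : DifferentiableAt ℝ P x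
  diff_Z : ∀ α, DifferentiableAt ℝ (Z α) x
  symm : ∀ᶠ y in 𝓝 x, ∀ u v, G y u v = G y v u
  pos : ∀ v, v ≠ 0 → 0 < G x v v
  sq : ∀ᶠ y in 𝓝 x, ∀ v, P y (P y v) = -v + ∑ α, G y v (Z α y) • Z α y
  orthonormal : ∀ᶠ y in 𝓝 x, ∀ α β, G y (Z β y) (Z α y) = if α = β then 1 else 0
  P_Z : ∀ᶠ y in 𝓝 x, ∀ α, P y (Z α y) = 0
  G_P_Z : ∀ᶠ y in 𝓝 x, ∀ α v, G y (P y v) (Z α y) = 0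
  G_P_P : ∀ᶠ y in 𝓝 x, ∀ v w,
    G y (P y v) (P y w) = G y v w - ∑ α, G y v (Z α y) * G y w (Z α y)
  dη : ∀ α u v, fderiv ℝ (fun y => G y v (Z α y)) x u = fderiv ℝ (fun y => G y u (Z α y)) x v
  dΩ : ∀ u v w, fderiv ℝ (fun y => G y v (P y w)) x u + fderiv ℝ (fun y => G y w (P y u)) x v
    + fderiv ℝ (fun y => G y u (P y v)) x w = 0
  nijenhuis : ∀ u v, fderiv ℝ P x (P x u) v - fderiv ℝ P x (P x v) u
    + P x (fderiv ℝ P x v u) - P x (fderiv ℝ P x u v) = 0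

/-- A constant function has zero derivative, in the form used to differentiate identities. -/
lemma hasFDerivAt_apply_eq_zero_of_eventually_eq {F : Type*} [NormedAddCommGroup F]
    [NormedSpace ℝ F] {f : E → F} {f' : E →L[ℝ] F} {x : E} (hf : HasFDerivAt f f' x) (c : F)
    (hc : ∀ᶠ y in 𝓝 x, f y = c) (u : E) : f' u = 0 := by
  have h1 : HasFDerivAt f (0 : E →L[ℝ] F) x :=
    (hasFDerivAt_const c x).congr_of_eventuallyEq hc
  rw [hf.unique h1]
  rfl

namespace LocalCStructure

variable {G : E → E →L[ℝ] E →L[ℝ] ℝ} {P : E → E →L[ℝ] E} {Z : Fin s → E → E} {x : E}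
  {Γ : E → E → E}

lemma nondeg (h : LocalCStructure G P Z x) (v : E) (hv : ∀ w, G x v w = 0) : v = 0 := by
  by_contra hne
  exact (h.pos v hne).ne' (hv v)

lemma ext_G (h : LocalCStructure G P Z x) {v w : E} (hv : ∀ z, G x v z = G x w z) : v = w := by
  refine sub_eq_zero.1 (h.nondeg _ fun z => ?_)
  rw [map_sub, sub_apply, hv, sub_self]

/-- `P` is skew-symmetric. -/
lemma skew (h : LocalCStructure G P Z x) :
    ∀ᶠ y in 𝓝 x, ∀ v w, G y (P y v) w + G y v (P y w) = 0 := by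
  filter_upwards [h.sq, h.G_P_P, h.G_P_Z] with y h1 h2 h3 v w
  have h4 := h2 v (P y w)
  rw [h1] at h4
  simp only [map_add, map_neg, map_sum, map_smul, h3, smul_zero, mul_zero,
    Finset.sum_const_zero] at h4
  linarith

lemma fderiv_G_symm (h : LocalCStructure G P Z x) (u v w : E) :
    fderiv ℝ G x u v w = fderiv ℝ G x u w v := by
  have h1 := ((h.diff_G.hasFDerivAt.clm_apply (hasFDerivAt_const v x)).clm_apply
    (hasFDerivAt_const w x)).sub ((h.diff_G.hasFDerivAt.clm_apply
    (hasFDerivAt_const w x)).clm_apply (hasFDerivAt_const v x))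
  have h2 := hasFDerivAt_apply_eq_zero_of_eventually_eq h1 0
    (by filter_upwards [h.symm] with y hy; simp [hy v w]) u
  simp at h2
  linarith

lemma christoffel_symm (h : LocalCStructure G P Z x) (hΓ : IsChristoffel G x Γ) (u v : E) :
    Γ u v = Γ v u := by
  refine h.ext_G fun z => ?_
  rw [hΓ, hΓ, h.fderiv_G_symm z u v]
  ring

lemma christoffel_add (h : LocalCStructure G P Z x) (hΓ : IsChristoffel G x Γ) (u v w : E) :
    Γ u (v + w) = Γ u v + Γ u w := by
  refine h.ext_G fun z => ?_
  rw [map_add, add_apply, hΓ, hΓ, hΓ, (fderiv ℝ G x).map_add v w, map_add, add_apply, add_apply,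
    add_apply, map_add]
  ring

lemma christoffel_smul (h : LocalCStructure G P Z x) (hΓ : IsChristoffel G x Γ) (c : ℝ)
    (u v : E) : Γ u (c • v) = c • Γ u v := by
  refine h.ext_G fun z => ?_
  rw [map_smul, smul_apply, hΓ, hΓ, (fderiv ℝ G x).map_smul c v, map_smul, smul_apply, smul_apply,
    smul_apply, map_smul]
  simp only [smul_eq_mul]
  ring

/-- The Christoffel symbol as a bilinear map. -/
def christoffelLin (h : LocalCStructure G P Z x) (hΓ : IsChristoffel G x Γ) :
    E →ₗ[ℝ] E →ₗ[ℝ] E :=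
  LinearMap.mk₂ ℝ Γ
    (fun u v w => by
      rw [h.christoffel_symm hΓ, h.christoffel_add hΓ, h.christoffel_symm hΓ w,
        h.christoffel_symm hΓ w])
    (fun c u v => by
      rw [h.christoffel_symm hΓ, h.christoffel_smul hΓ, h.christoffel_symm hΓ v])
    (h.christoffel_add hΓ) (fun c u v => h.christoffel_smul hΓ c u v)

lemma christoffelLin_apply (h : LocalCStructure G P Z x) (hΓ : IsChristoffel G x Γ) (u v : E) :
    h.christoffelLin hΓ u v = Γ u v := rfl

/-- Metric compatibility, for vector fields `a`, `b` with values and derivatives given at `x`. -/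
lemma hasFDerivAt_metric (h : LocalCStructure G P Z x) (hΓ : IsChristoffel G x Γ) {a b : E → E}
    {a' b' : E →L[ℝ] E} (ha : HasFDerivAt a a' x) (hb : HasFDerivAt b b' x) :
    ∃ f' : E →L[ℝ] ℝ, HasFDerivAt (fun y => G y (a y) (b y)) f' x ∧
      ∀ u, f' u = G x (a' u + Γ u (a x)) (b x) + G x (a x) (b' u + Γ u (b x)) := by
  refine ⟨_, (h.diff_G.hasFDerivAt.clm_apply ha).clm_apply hb, fun u => ?_⟩
  have h1 := hΓ u (a x) (b x)
  have h2 := hΓ u (b x) (a x)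
  have h3 := h.symm.self_of_nhds (a x) (Γ u (b x))
  have h4 := h.fderiv_G_symm u (a x) (b x)
  simp only [add_apply, ContinuousLinearMap.comp_apply,
    ContinuousLinearMap.flip_apply, map_add]
  linarith

/-- The covariant derivative `∇P` at `x`. -/
def nablaP (h : LocalCStructure G P Z x) (hΓ : IsChristoffel G x Γ) : E →ₗ[ℝ] E →ₗ[ℝ] E :=
  LinearMap.mk₂ ℝ (fun u v => fderiv ℝ P x u v + h.christoffelLin hΓ u (P x v)
      - P x (h.christoffelLin hΓ u v))
    (fun u v w => by simp only [map_add, add_apply, LinearMap.add_apply]; abel)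
    (fun c u v => by
      simp only [map_smul, smul_apply, LinearMap.smul_apply, smul_sub,
        smul_add])
    (fun u v w => by simp only [map_add]; abel)
    (fun c u v => by simp only [map_smul, smul_sub, smul_add])

lemma nablaP_apply (h : LocalCStructure G P Z x) (hΓ : IsChristoffel G x Γ) (u v : E) :
    h.nablaP hΓ u v = fderiv ℝ P x u v + h.christoffelLin hΓ u (P x v)
      - P x (h.christoffelLin hΓ u v) := rfl

/-- The covariant derivative `∇Z_α` at `x`. -/
def nablaZ (h : LocalCStructure G P Z x) (hΓ : IsChristoffel G x Γ) (α : Fin s) : E →ₗ[ℝ] E :=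
  (fderiv ℝ (Z α) x : E →ₗ[ℝ] E) + (h.christoffelLin hΓ).flip (Z α x)

lemma nablaZ_apply (h : LocalCStructure G P Z x) (hΓ : IsChristoffel G x Γ) (α : Fin s) (u : E) :
    h.nablaZ hΓ α u = fderiv ℝ (Z α) x u + h.christoffelLin hΓ u (Z α x) := rfl

/-- The metric at `x` as a bilinear map. -/
def metricLin (G : E → E →L[ℝ] E →L[ℝ] ℝ) (x : E) : E →ₗ[ℝ] E →ₗ[ℝ] ℝ :=
  LinearMap.mk₂ ℝ (fun u v => G x u v) (by simp) (by simp) (by simp) (by simp)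

lemma metricLin_apply (u v : E) : metricLin G x u v = G x u v := rfl

/-- The identities between `∇P` and `∇Z_α` obtained by differentiating the structure equations. -/
lemma pointwise (h : LocalCStructure G P Z x) (hΓ : IsChristoffel G x Γ) :
    PointwiseCStructure (metricLin G x) (P x : E →ₗ[ℝ] E) (fun α => Z α x) (h.nablaP hΓ)
      (h.nablaZ hΓ) := by
  have hs := h.symm.self_of_nhds
  have hk := h.skew.self_of_nhds
  have hP := h.diff_P.hasFDerivAt
  have hZ := fun α => (h.diff_Z α).hasFDerivAt
  have hc := fun v : E => hasFDerivAt_const (𝕜 := ℝ) v x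
  have hPc : ∀ v : E, HasFDerivAt (fun y => P y v) ((fderiv ℝ P x).flip v) x := fun v => by
    simpa using hP.clm_apply (hc v)
  have hsymm := fun u v => h.christoffel_symm hΓ u v
  have hA_skew : ∀ u v w, G x (h.nablaP hΓ u v) w = -G x (h.nablaP hΓ u w) v := by
    intro u v w
    obtain ⟨f₁, hf₁, hf₁'⟩ := h.hasFDerivAt_metric hΓ (hPc v) (hc w)
    obtain ⟨f₂, hf₂, hf₂'⟩ := h.hasFDerivAt_metric hΓ (hc v) (hPc w)
    have h1 := hasFDerivAt_apply_eq_zero_of_eventually_eq (hf₁.add hf₂) 0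
      (h.skew.mono fun y hy => hy v w) u
    rw [add_apply, hf₁', hf₂'] at h1
    have h2 := hk (Γ u v) w
    have h3 := hk v (Γ u w)
    rw [hs (h.nablaP hΓ u w) v]
    simp only [nablaP_apply, christoffelLin_apply, map_add, map_sub,
      add_apply, sub_apply,
      ContinuousLinearMap.flip_apply, zero_apply, map_zero] at h1 ⊢
    linarith
  refine ⟨hs, h.nondeg, h.sq.self_of_nhds, h.P_Z.self_of_nhds, h.G_P_Z.self_of_nhds,
    fun v w => eq_neg_of_add_eq_zero_left (hk v w), hA_skew, ?_, ?_, ?_, ?_, ?_, ?_⟩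
  · intro u w v
    have key : ∀ u v w, fderiv ℝ (fun y => G y v (P y w)) x u =
        G x (Γ u v) (P x w) + G x (h.nablaP hΓ u w) v + G x v (P x (Γ u w)) := by
      intro u v w
      obtain ⟨f₂, hf₂, hf₂'⟩ := h.hasFDerivAt_metric hΓ (hc v) (hPc w)
      rw [hf₂.fderiv, hf₂', hs (h.nablaP hΓ u w) v]
      simp only [nablaP_apply, christoffelLin_apply, map_add, map_sub,
        add_apply, ContinuousLinearMap.flip_apply,
        zero_apply, map_zero]
      ring
    have h1 := h.dΩ u v w
    rw [key, key, key, hsymm w u, hsymm v u, hsymm w v] at h1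
    have h2 := hk (Γ u v) w
    have h3 := hk (Γ u w) v
    have h4 := hk (Γ v w) u
    have h5 := hs (P x (Γ u v)) w
    have h6 := hs (P x (Γ u w)) v
    have h7 := hs (P x (Γ v w)) u
    simp only [metricLin_apply]
    linarith
  · intro u v
    have h1 := h.nijenhuis u v
    simp only [ContinuousLinearMap.coe_coe, nablaP_apply, christoffelLin_apply, map_add, map_sub,
      hsymm (P x v) (P x u), hsymm (P x v) u, hsymm v (P x u), hsymm v u]
    rw [← h1]
    abel
  · intro α u v
    obtain ⟨f₁, hf₁, hf₁'⟩ := h.hasFDerivAt_metric hΓ (hc v) (hZ α)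
    obtain ⟨f₂, hf₂, hf₂'⟩ := h.hasFDerivAt_metric hΓ (hc u) (hZ α)
    have h1 := h.dη α u v
    rw [hf₁.fderiv, hf₂.fderiv, hf₁', hf₂', hsymm v u] at h1
    simp only [metricLin_apply]
    rw [hs _ v, hs _ u]
    simpa [nablaZ_apply, christoffelLin_apply] using h1
  · intro α u
    have h1 := hasFDerivAt_apply_eq_zero_of_eventually_eq (hP.clm_apply (hZ α)) 0
      (h.P_Z.mono fun y hy => hy α) u
    simp only [add_apply, ContinuousLinearMap.comp_apply,
      ContinuousLinearMap.flip_apply] at h1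
    simp only [ContinuousLinearMap.coe_coe, nablaP_apply, nablaZ_apply, h.P_Z.self_of_nhds,
      map_zero, add_zero, map_add]
    rw [neg_add, ← eq_neg_of_add_eq_zero_right h1]
    abel
  · intro α β u
    obtain ⟨f₁, hf₁, hf₁'⟩ := h.hasFDerivAt_metric hΓ (hZ α) (hZ β)
    have h1 := hasFDerivAt_apply_eq_zero_of_eventually_eq hf₁ _
      (h.orthonormal.mono fun y hy => hy β α) u
    rw [hf₁', hs (Z α x)] at h1
    exact eq_neg_of_add_eq_zero_left h1
  · intro u v
    choose f hf hf' using fun α => h.hasFDerivAt_metric hΓ (hc v) (hZ α)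
    have h1 := hasFDerivAt_apply_eq_zero_of_eventually_eq ((hP.clm_apply (hPc v)).sub
      (HasFDerivAt.fun_sum (u := Finset.univ) fun α _ => (hf α).smul (hZ α))) (-v)
      (h.sq.mono fun y hy => by simp [hy v]) u
    have h2 : fderiv ℝ P x u (P x v) + P x (fderiv ℝ P x u v) =
        ∑ α, ((G x (Γ u v) (Z α x) + G x v (h.nablaZ hΓ α u)) • Z α x
          + G x v (Z α x) • fderiv ℝ (Z α) x u) := by
      rw [← sub_eq_zero, ← h1]
      simp only [sub_apply, add_apply,
        ContinuousLinearMap.comp_apply, ContinuousLinearMap.flip_apply, hf',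
        sum_apply, smul_apply,
        ContinuousLinearMap.smulRight_apply, nablaZ_apply, christoffelLin_apply,
        zero_apply, zero_add]
      rw [add_comm (fderiv ℝ P x u (P x v))]
      congr 1
      refine Finset.sum_congr rfl fun α _ => add_comm _ _
    simp only [ContinuousLinearMap.coe_coe, nablaP_apply, map_sub, map_add, metricLin_apply]
    have h3 : fderiv ℝ P x u (P x v) + h.christoffelLin hΓ u (P x (P x v))
        - P x (h.christoffelLin hΓ u (P x v)) + (P x (fderiv ℝ P x u v)
          + P x (h.christoffelLin hΓ u (P x v)) - P x (P x (h.christoffelLin hΓ u v)))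
        = (fderiv ℝ P x u (P x v) + P x (fderiv ℝ P x u v))
          + h.christoffelLin hΓ u (P x (P x v)) - P x (P x (h.christoffelLin hΓ u v)) := by
      abel
    have h4 : ∀ α, G x (h.nablaZ hΓ α u) v = G x v (h.nablaZ hΓ α u) := fun α => hs _ v
    rw [h3, h2, h.sq.self_of_nhds v, h.sq.self_of_nhds (h.christoffelLin hΓ u v)]
    simp only [h4]
    simp only [map_add, map_neg, map_sum, map_smul, add_smul, nablaZ_apply, smul_add,
      Finset.sum_add_distrib, christoffelLin_apply]
    abel

/-- `∇P = 0`, written out in coordinates. -/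
theorem fderiv_P (h : LocalCStructure G P Z x) (hΓ : IsChristoffel G x Γ) (u v : E) :
    fderiv ℝ P x u v + Γ u (P x v) = P x (Γ u v) :=
  sub_eq_zero.1 ((h.pointwise hΓ).A_eq_zero u v)

/-- `∇Z_α = 0`, written out in coordinates. -/
theorem fderiv_Z (h : LocalCStructure G P Z x) (hΓ : IsChristoffel G x Γ) (α : Fin s) (u : E) :
    fderiv ℝ (Z α) x u + Γ u (Z α x) = 0 :=
  (h.pointwise hΓ).B_eq_zero α u

end LocalCStructure

end Local

/-! ### Tensor fields in the coordinates of a chart -/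

section Coordinates

variable {d : ℕ} {M : Type*} [TopologicalSpace M]
  [ChartedSpace (EuclideanSpace ℝ (Fin d)) M]

/-- The coordinate frame of the chart around `p` at the point with coordinates `y`, as a linear map
from the model space to the tangent space (which is definitionally the model space). -/
def chartFrame (p : M) (y : EuclideanSpace ℝ (Fin d)) :
    EuclideanSpace ℝ (Fin d) →L[ℝ] EuclideanSpace ℝ (Fin d) :=
  mfderiv 𝓘(ℝ, EuclideanSpace ℝ (Fin d)) (𝓡 d) (extChartAt (𝓡 d) p).symm y

/-- The differential at `x` of the chart around `p`. -/
def chartDiff (p x : M) : EuclideanSpace ℝ (Fin d) →L[ℝ] EuclideanSpace ℝ (Fin d) :=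
  mfderiv (𝓡 d) 𝓘(ℝ, EuclideanSpace ℝ (Fin d)) (extChartAt (𝓡 d) p) x

/-- The vector field with constant coordinates `u` in the chart around `p`. -/
def constField (p : M) (u : EuclideanSpace ℝ (Fin d)) (x : M) : TangentSpace (𝓡 d) x :=
  chartFrame p (extChartAt (𝓡 d) p x) u

/-- The coordinate expression of a vector field in the chart around `p`. -/
def coordVec (V : ∀ x : M, TangentSpace (𝓡 d) x) (p : M) (y : EuclideanSpace ℝ (Fin d)) :
    EuclideanSpace ℝ (Fin d) :=
  chartDiff p ((extChartAt (𝓡 d) p).symm y) (V ((extChartAt (𝓡 d) p).symm y))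

/-- The coordinate expression of a (1,1)-tensor field in the chart around `p`. -/
def coordEndo (φ : ∀ x : M, TangentSpace (𝓡 d) x →L[ℝ] TangentSpace (𝓡 d) x) (p : M)
    (y : EuclideanSpace ℝ (Fin d)) : EuclideanSpace ℝ (Fin d) →L[ℝ] EuclideanSpace ℝ (Fin d) :=
  (chartDiff p ((extChartAt (𝓡 d) p).symm y)).comp
    (ContinuousLinearMap.comp (M₂ := EuclideanSpace ℝ (Fin d))
      (φ ((extChartAt (𝓡 d) p).symm y)) (chartFrame p y))

lemma coordVec_extChartAt (V : ∀ x : M, TangentSpace (𝓡 d) x) (p : M) {x : M}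
    (hx : x ∈ (extChartAt (𝓡 d) p).source) :
    coordVec V p (extChartAt (𝓡 d) p x) = chartDiff p x (V x) :=
  congrArg (fun z => chartDiff p z (V z)) ((extChartAt (𝓡 d) p).left_inv hx)

lemma eventually_mem_target (p : M) :
    ∀ᶠ y in 𝓝 (extChartAt (𝓡 d) p p), y ∈ (extChartAt (𝓡 d) p).target :=
  extChartAt_target_mem_nhds p

lemma coordEndo_apply (φ : ∀ x : M, TangentSpace (𝓡 d) x →L[ℝ] TangentSpace (𝓡 d) x) (p : M)
    {y : EuclideanSpace ℝ (Fin d)} (hy : y ∈ (extChartAt (𝓡 d) p).target)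
    (u : EuclideanSpace ℝ (Fin d)) :
    coordEndo φ p y u = coordVec (fun x => φ x (constField p u x)) p y := by
  simp only [coordVec, constField, (extChartAt (𝓡 d) p).right_inv hy]
  rfl

lemma eventually_mem_source {γ : ℝ → M} {J : Set ℝ}
    (hγ : ContMDiffOn 𝓘(ℝ, ℝ) (𝓡 d) ∞ γ J) {t : ℝ} (ht : t ∈ J) :
    ∀ᶠ τ in 𝓝[J] t, γ τ ∈ (extChartAt (𝓡 d) (γ t)).source :=
  (hγ t ht).continuousWithinAt.eventually (extChartAt_source_mem_nhds (γ t))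

variable [IsManifold (𝓡 d) ∞ M]

lemma chartDiff_chartFrame (p : M) {y : EuclideanSpace ℝ (Fin d)}
    (hy : y ∈ (extChartAt (𝓡 d) p).target) (u : EuclideanSpace ℝ (Fin d)) :
    chartDiff p ((extChartAt (𝓡 d) p).symm y) (chartFrame p y u) = u := by
  have : IsManifold (𝓡 d) 1 M := IsManifold.of_le (n := ∞) (by norm_cast)
  have h := mfderiv_extChartAt_comp_mfderivWithin_extChartAt_symm hy
  rw [ModelWithCorners.range_eq_univ, mfderivWithin_univ] at h
  exact DFunLike.congr_fun h u

lemma chartFrame_chartDiff (p : M) {x : M} (hx : x ∈ (extChartAt (𝓡 d) p).source)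
    (u : EuclideanSpace ℝ (Fin d)) :
    chartFrame p (extChartAt (𝓡 d) p x) (chartDiff p x u) = u := by
  have : IsManifold (𝓡 d) 1 M := IsManifold.of_le (n := ∞) (by norm_cast)
  have h := mfderivWithin_extChartAt_symm_comp_mfderiv_extChartAt' hx
  rw [ModelWithCorners.range_eq_univ, mfderivWithin_univ] at h
  exact DFunLike.congr_fun h u

lemma chartDiff_constField (p : M) {x : M} (hx : x ∈ (extChartAt (𝓡 d) p).source)
    (u : EuclideanSpace ℝ (Fin d)) : chartDiff p x (constField p u x) = u := by
  have h := chartDiff_chartFrame p ((extChartAt (𝓡 d) p).map_source hx) u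
  rwa [(extChartAt (𝓡 d) p).left_inv hx] at h

lemma chartDiff_self (p : M) : chartDiff (d := d) p p = ContinuousLinearMap.id ℝ _ := by
  have : IsManifold (𝓡 d) 1 M := IsManifold.of_le (n := ∞) (by norm_cast)
  exact mfderiv_extChartAt_self

lemma chartFrame_chartDiff_symm (p : M) {y : EuclideanSpace ℝ (Fin d)}
    (hy : y ∈ (extChartAt (𝓡 d) p).target) (u : EuclideanSpace ℝ (Fin d)) :
    chartFrame p y (chartDiff p ((extChartAt (𝓡 d) p).symm y) u) = u := by
  have h := chartFrame_chartDiff p ((extChartAt (𝓡 d) p).map_target hy) u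
  rwa [(extChartAt (𝓡 d) p).right_inv hy] at h

lemma constField_self (p : M) (u : EuclideanSpace ℝ (Fin d)) : constField p u p = u := by
  have h := chartFrame_chartDiff p (mem_extChartAt_source (I := 𝓡 d) p) u
  rwa [chartDiff_self] at h

lemma trivializationAt_eq_chartDiff (p : M) {x : M} (hx : x ∈ (extChartAt (𝓡 d) p).source)
    (v : TangentSpace (𝓡 d) x) :
    (trivializationAt (EuclideanSpace ℝ (Fin d)) (TangentSpace (𝓡 d)) p
      (⟨x, v⟩ : TangentBundle (𝓡 d) M)).2 = chartDiff p x v := by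
  have : IsManifold (𝓡 d) 1 M := IsManifold.of_le (n := ∞) (by norm_cast)
  rw [extChartAt_source] at hx
  have h := TangentBundle.continuousLinearMapAt_trivializationAt (I := 𝓡 d) hx
  have h1 := DFunLike.congr_fun h v
  refine Eq.trans ?_ h1
  rw [Bundle.Trivialization.continuousLinearMapAt_apply,
    Bundle.Trivialization.coe_linearMapAt_of_mem _ (by simpa using hx)]

lemma isSmoothFieldOn_constField (p : M) (u : EuclideanSpace ℝ (Fin d)) :
    IsSmoothFieldOn (constField p u) (extChartAt (𝓡 d) p).source := by
  refine (Bundle.Trivialization.contMDiffOn_section_iff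
    (trivializationAt (EuclideanSpace ℝ (Fin d)) (TangentSpace (𝓡 d)) p)
    (isOpen_extChartAt_source p) (by simp)).2 ?_
  refine (contMDiffOn_const (c := u)).congr fun x hx => ?_
  rw [trivializationAt_eq_chartDiff p hx, chartDiff_constField p hx]

/-- A function on the manifold that is smooth at `p`, read in the chart around `p`. -/
lemma contDiffAt_comp_symm {F : Type*} [NormedAddCommGroup F] [NormedSpace ℝ F] {f : M → F}
    {p : M} (hf : ContMDiffAt (𝓡 d) 𝓘(ℝ, F) ∞ f p) :
    ContDiffAt ℝ ∞ (fun y => f ((extChartAt (𝓡 d) p).symm y)) (extChartAt (𝓡 d) p p) := by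
  rw [← contMDiffAt_iff_contDiffAt]
  have h1 : ContMDiffAt 𝓘(ℝ, EuclideanSpace ℝ (Fin d)) (𝓡 d) ∞ (extChartAt (𝓡 d) p).symm
      (extChartAt (𝓡 d) p p) :=
    (contMDiffOn_extChartAt_symm p).contMDiffAt (extChartAt_target_mem_nhds p)
  refine ContMDiffAt.comp (extChartAt (𝓡 d) p p) (g := f) ?_ h1
  rwa [extChartAt_to_inv]

lemma contDiffAt_coordVec {V : ∀ x : M, TangentSpace (𝓡 d) x} {p : M}
    (hV : ContMDiffAt (𝓡 d) (𝓡 d).tangent ∞ (fun x : M => (⟨x, V x⟩ : TangentBundle (𝓡 d) M)) p) :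
    ContDiffAt ℝ ∞ (coordVec V p) (extChartAt (𝓡 d) p p) := by
  have h1 := contDiffAt_comp_symm ((Bundle.contMDiffAt_section p).1 hV)
  refine h1.congr_of_eventuallyEq ?_
  filter_upwards [eventually_mem_target p] with y hy
  rw [trivializationAt_eq_chartDiff p ((extChartAt (𝓡 d) p).map_target hy)]
  rfl

lemma contMDiffAt_constField (p : M) (u : EuclideanSpace ℝ (Fin d)) :
    ContMDiffAt (𝓡 d) (𝓡 d).tangent ∞
      (fun x : M => (⟨x, constField p u x⟩ : TangentBundle (𝓡 d) M)) p :=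
  (isSmoothFieldOn_constField p u).contMDiffAt (extChartAt_source_mem_nhds p)

lemma coordMetric_apply (g : Bundle.ContMDiffRiemannianMetric (𝓡 d) ∞ (EuclideanSpace ℝ (Fin d))
      (fun p : M => TangentSpace (𝓡 d) p)) (p : M) {y : EuclideanSpace ℝ (Fin d)}
    (hy : y ∈ (extChartAt (𝓡 d) p).target) (u v : EuclideanSpace ℝ (Fin d)) :
    coordMetric g p y u v = g.inner ((extChartAt (𝓡 d) p).symm y)
      (constField p u ((extChartAt (𝓡 d) p).symm y))
      (constField p v ((extChartAt (𝓡 d) p).symm y)) := by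
  simp only [constField, (extChartAt (𝓡 d) p).right_inv hy]
  rfl

/-- Differentiability of a field of linear maps on a finite-dimensional space can be tested on
vectors. -/
lemma differentiableAt_clm_of_apply {E F : Type*} [NormedAddCommGroup E] [NormedSpace ℝ E]
    [FiniteDimensional ℝ E] {D : Type*} [NormedAddCommGroup D] [NormedSpace ℝ D]
    [NormedAddCommGroup F] [NormedSpace ℝ F] {f : D → E →L[ℝ] F} {x : D}
    (hf : ∀ v, DifferentiableAt ℝ (fun y => f y v) x) : DifferentiableAt ℝ f x := by
  let b := Module.finBasis ℝ E
  have h : f = fun y => ∑ i, ((b.coord i).toContinuousLinearMap).smulRight (f y (b i)) := by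
    funext y
    ext v
    conv_lhs => rw [← b.sum_repr v, map_sum]
    simp
  rw [h]
  refine DifferentiableAt.fun_sum fun i _ => ?_
  exact ((ContinuousLinearMap.smulRightL ℝ E F
    ((b.coord i).toContinuousLinearMap)).differentiableAt).comp x (hf (b i))

lemma differentiableAt_coordEndo {φ : ∀ x : M, TangentSpace (𝓡 d) x →L[ℝ] TangentSpace (𝓡 d) x}
    (hφ : ContMDiff (𝓡 d) ((𝓡 d).prod 𝓘(ℝ, EuclideanSpace ℝ (Fin d) →L[ℝ]
        EuclideanSpace ℝ (Fin d))) ∞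
      (fun p : M => Bundle.TotalSpace.mk' (EuclideanSpace ℝ (Fin d) →L[ℝ]
        EuclideanSpace ℝ (Fin d))
        (E := fun p : M => TangentSpace (𝓡 d) p →L[ℝ] TangentSpace (𝓡 d) p) p (φ p))) (p : M) :
    DifferentiableAt ℝ (coordEndo φ p) (extChartAt (𝓡 d) p p) := by
  refine differentiableAt_clm_of_apply fun u => ?_
  have h1 := (hφ p).clm_bundle_apply (contMDiffAt_constField p u)
  refine ((contDiffAt_coordVec h1).differentiableAt (by simp)).congr_of_eventuallyEq ?_
  filter_upwards [eventually_mem_target p] with y hy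
  exact coordEndo_apply φ p hy u

lemma contMDiffAt_inner (g : Bundle.ContMDiffRiemannianMetric (𝓡 d) ∞ (EuclideanSpace ℝ (Fin d))
      (fun p : M => TangentSpace (𝓡 d) p)) {V W : ∀ x : M, TangentSpace (𝓡 d) x} {p : M}
    (hV : ContMDiffAt (𝓡 d) (𝓡 d).tangent ∞ (fun x : M => (⟨x, V x⟩ : TangentBundle (𝓡 d) M)) p)
    (hW : ContMDiffAt (𝓡 d) (𝓡 d).tangent ∞ (fun x : M => (⟨x, W x⟩ : TangentBundle (𝓡 d) M)) p) :
    ContMDiffAt (𝓡 d) 𝓘(ℝ, ℝ) ∞ (fun x => g.inner x (V x) (W x)) p := by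
  have h1 := ContMDiffAt.clm_bundle_apply₂ (F₃ := ℝ) (E₃ := Bundle.Trivial M ℝ) (g.contMDiff p)
    hV hW
  simp only [Bundle.contMDiffAt_totalSpace] at h1
  exact h1.2

lemma differentiableAt_coordMetric
    (g : Bundle.ContMDiffRiemannianMetric (𝓡 d) ∞ (EuclideanSpace ℝ (Fin d))
      (fun p : M => TangentSpace (𝓡 d) p)) (p : M) :
    DifferentiableAt ℝ (coordMetric g p) (extChartAt (𝓡 d) p p) := by
  refine differentiableAt_clm_of_apply fun u => differentiableAt_clm_of_apply fun v => ?_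
  have h1 := contDiffAt_comp_symm
    (contMDiffAt_inner g (contMDiffAt_constField p u) (contMDiffAt_constField p v))
  refine (h1.differentiableAt (by simp)).congr_of_eventuallyEq ?_
  filter_upwards [eventually_mem_target p] with y hy
  exact coordMetric_apply g p hy u v

end Coordinates

/-! ### Brackets and derivatives at the centre of a chart -/

section Centre

variable {d : ℕ} {M : Type*} [TopologicalSpace M]
  [ChartedSpace (EuclideanSpace ℝ (Fin d)) M] [IsManifold (𝓡 d) ∞ M]

lemma dirDeriv_constField {f : M → ℝ} {p : M} (hf : ContMDiffAt (𝓡 d) 𝓘(ℝ, ℝ) ∞ f p)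
    (u : EuclideanSpace ℝ (Fin d)) :
    dirDeriv (constField p u) f p =
      fderiv ℝ (fun y => f ((extChartAt (𝓡 d) p).symm y)) (extChartAt (𝓡 d) p p) u := by
  have h1 : MDifferentiableAt (𝓡 d) 𝓘(ℝ, ℝ) f p := hf.mdifferentiableAt (by simp)
  have h2 := constField_self p u
  unfold dirDeriv
  rw [h2]
  have h3 := h1.hasMFDerivAt.2
  rw [ModelWithCorners.range_eq_univ] at h3
  have key : ∀ A : EuclideanSpace ℝ (Fin d) →L[ℝ] ℝ,
      HasFDerivWithinAt (fun y => f ((extChartAt (𝓡 d) p).symm y)) A Set.univ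
        (extChartAt (𝓡 d) p p) →
      A u = fderiv ℝ (fun y => f ((extChartAt (𝓡 d) p).symm y)) (extChartAt (𝓡 d) p p) u :=
    fun A hA => by rw [(hasFDerivWithinAt_univ.1 hA).fderiv]
  exact key _ h3

lemma mlieBracket_eq_lieBracket (V W : ∀ x : M, TangentSpace (𝓡 d) x) (p : M) :
    VectorField.mlieBracket (𝓡 d) V W p =
      VectorField.lieBracket ℝ (coordVec V p) (coordVec W p) (extChartAt (𝓡 d) p p) := by
  have : IsManifold (𝓡 d) 1 M := IsManifold.of_le (n := ∞) (by norm_cast)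
  have hpull : ∀ V : ∀ x : M, TangentSpace (𝓡 d) x,
      VectorField.mpullbackWithin 𝓘(ℝ, EuclideanSpace ℝ (Fin d)) (𝓡 d)
        (extChartAt (𝓡 d) p).symm V Set.univ =ᶠ[𝓝 (extChartAt (𝓡 d) p p)] coordVec V p := by
    intro V
    filter_upwards [eventually_mem_target p] with y hy
    have h1 := mfderivWithin_extChartAt_symm_comp_mfderiv_extChartAt hy
    have h2 := mfderiv_extChartAt_comp_mfderivWithin_extChartAt_symm hy
    rw [ModelWithCorners.range_eq_univ] at h1 h2
    rw [VectorField.mpullbackWithin_apply, ContinuousLinearMap.inverse_eq h1 h2]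
    rfl
  rw [← VectorField.mlieBracketWithin_univ, VectorField.mlieBracketWithin_apply]
  have h3 : mfderiv (𝓡 d) 𝓘(ℝ, EuclideanSpace ℝ (Fin d)) (extChartAt (𝓡 d) p) p =
    ContinuousLinearMap.id ℝ _ := mfderiv_extChartAt_self
  rw [h3, ModelWithCorners.range_eq_univ, Set.preimage_univ, Set.univ_inter]
  have h4 := ContinuousLinearMap.inverse_id (R := ℝ) (M := EuclideanSpace ℝ (Fin d))
  refine (DFunLike.congr_fun h4 _).trans ?_
  refine Eq.trans ?_ ((hpull V).lieBracket_vectorField_eq (hpull W))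
  exact congrFun VectorField.lieBracketWithin_univ _

lemma coordVec_constField (p : M) (u : EuclideanSpace ℝ (Fin d)) :
    coordVec (constField p u) p =ᶠ[𝓝 (extChartAt (𝓡 d) p p)] fun _ => u := by
  filter_upwards [eventually_mem_target p] with y hy
  exact chartDiff_constField p ((extChartAt (𝓡 d) p).map_target hy) u

lemma lieBracket_eq_of_hasFDerivAt {E : Type*} [NormedAddCommGroup E] [NormedSpace ℝ E]
    {V W : E → E} {V' W' : E →L[ℝ] E} {x : E} (hV : HasFDerivAt V V' x)
    (hW : HasFDerivAt W W' x) : VectorField.lieBracket ℝ V W x = W' (V x) - V' (W x) := by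
  rw [VectorField.lieBracket, hV.fderiv, hW.fderiv]

end Centre

/-! ### C-manifolds in coordinates -/

section CManifold

variable {n s : ℕ} {M : Type*} [TopologicalSpace M]
  [ChartedSpace (EuclideanSpace ℝ (Fin (2 * n + s))) M] [IsManifold (𝓡 (2 * n + s)) ∞ M]

lemma coordEndo_self {d : ℕ} {M : Type*} [TopologicalSpace M]
    [ChartedSpace (EuclideanSpace ℝ (Fin d)) M] [IsManifold (𝓡 d) ∞ M]
    (φ : ∀ x : M, TangentSpace (𝓡 d) x →L[ℝ] TangentSpace (𝓡 d) x) (p : M)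
    (u : EuclideanSpace ℝ (Fin d)) : coordEndo φ p (extChartAt (𝓡 d) p p) u = φ p u := by
  rw [coordEndo_apply φ p (mem_extChartAt_target p),
    coordVec_extChartAt _ p (mem_extChartAt_source p), chartDiff_self, constField_self]
  rfl

lemma coordMetric_pos {d : ℕ} {M : Type*} [TopologicalSpace M]
    [ChartedSpace (EuclideanSpace ℝ (Fin d)) M] [IsManifold (𝓡 d) ∞ M]
    (g : Bundle.ContMDiffRiemannianMetric (𝓡 d) ∞ (EuclideanSpace ℝ (Fin d))
      (fun p : M => TangentSpace (𝓡 d) p)) (p : M) {y : EuclideanSpace ℝ (Fin d)}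
    (hy : y ∈ (extChartAt (𝓡 d) p).target) {v : EuclideanSpace ℝ (Fin d)} (hv : v ≠ 0) :
    0 < coordMetric g p y v v := by
  refine g.pos ((extChartAt (𝓡 d) p).symm y) (chartFrame p y v) fun h => hv ?_
  have h1 := chartDiff_chartFrame p hy v
  rw [← h1]
  exact (congrArg _ h).trans (map_zero (chartDiff p ((extChartAt (𝓡 d) p).symm y)))

lemma FramedStructure.IsCManifold.localCStructure {S : FramedStructure n s M}
    (hS : S.IsCManifold) (p : M) :
    LocalCStructure (coordMetric S.g p) (coordEndo S.φ p) (fun α => coordVec (S.ξ α) p)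
      (extChartAt (𝓡 (2 * n + s)) p p) := by
  have hG : ∀ y u v, coordMetric S.g p y u v =
    S.g.inner ((extChartAt (𝓡 (2 * n + s)) p).symm y) (chartFrame p y u) (chartFrame p y v) :=
    fun y u v => rfl
  have hFP : ∀ y ∈ (extChartAt (𝓡 (2 * n + s)) p).target, ∀ u,
      chartFrame p y (coordEndo S.φ p y u) =
        S.φ ((extChartAt (𝓡 (2 * n + s)) p).symm y) (chartFrame p y u) :=
    fun y hy u => chartFrame_chartDiff_symm p hy _
  have hFZ : ∀ y ∈ (extChartAt (𝓡 (2 * n + s)) p).target, ∀ α,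
      chartFrame p y (coordVec (S.ξ α) p y) = S.ξ α ((extChartAt (𝓡 (2 * n + s)) p).symm y) :=
    fun y hy α => chartFrame_chartDiff_symm p hy _
  have hinj : ∀ y ∈ (extChartAt (𝓡 (2 * n + s)) p).target, ∀ u v,
      chartFrame p y u = chartFrame p y v → u = v := fun y hy u v h => by
    rw [← chartDiff_chartFrame p hy u, h, chartDiff_chartFrame p hy v]
  have hη : ∀ y ∈ (extChartAt (𝓡 (2 * n + s)) p).target, ∀ α u,
      coordMetric S.g p y u (coordVec (S.ξ α) p y) =
        S.η α ((extChartAt (𝓡 (2 * n + s)) p).symm y) (chartFrame p y u) := by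
    intro y hy α u
    rw [hG, hFZ y hy]
    exact (S.η_eq _ α _).symm
  have hξ : ∀ α, ContMDiffAt (𝓡 (2 * n + s)) (𝓡 (2 * n + s)).tangent ∞
      (fun x : M => (⟨x, S.ξ α x⟩ : TangentBundle (𝓡 (2 * n + s)) M)) p := fun α =>
    (S.ξ_smooth α).contMDiffAt Filter.univ_mem
  have hφc : ∀ u, ContMDiffAt (𝓡 (2 * n + s)) (𝓡 (2 * n + s)).tangent ∞
      (fun x : M => (⟨x, S.φ x (constField p u x)⟩ : TangentBundle (𝓡 (2 * n + s)) M)) p :=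
    fun u => (S.φ_smooth p).clm_bundle_apply (contMDiffAt_constField p u)
  have hP := differentiableAt_coordEndo S.φ_smooth p
  -- the brackets of constant fields and their images under `φ`
  have hbr : ∀ u v, VectorField.mlieBracket (𝓡 (2 * n + s)) (constField p u) (constField p v) p
      = (0 : EuclideanSpace ℝ (Fin (2 * n + s))) := by
    intro u v
    rw [mlieBracket_eq_lieBracket, (coordVec_constField p u).lieBracket_vectorField_eq
      (coordVec_constField p v), lieBracket_eq_of_hasFDerivAt (hasFDerivAt_const u _)
      (hasFDerivAt_const v _)]
    exact sub_self (0 : EuclideanSpace ℝ (Fin (2 * n + s)))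
  have hφv : ∀ u, coordVec (fun x => S.φ x (constField p u x)) p
      =ᶠ[𝓝 (extChartAt (𝓡 (2 * n + s)) p p)] fun y => coordEndo S.φ p y u := by
    intro u
    filter_upwards [eventually_mem_target p] with y hy
    exact (coordEndo_apply S.φ p hy u).symm
  have hPc : ∀ u, HasFDerivAt (fun y => coordEndo S.φ p y u)
      ((fderiv ℝ (coordEndo S.φ p) (extChartAt (𝓡 (2 * n + s)) p p)).flip u)
      (extChartAt (𝓡 (2 * n + s)) p p) := fun u => by
    simpa using hP.hasFDerivAt.clm_apply (hasFDerivAt_const u _)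
  have hsrc := isOpen_extChartAt_source (I := 𝓡 (2 * n + s)) p
  have hmem := mem_extChartAt_source (I := 𝓡 (2 * n + s)) p
  refine
    { diff_G := differentiableAt_coordMetric S.g p
      diff_P := hP
      diff_Z := fun α => (contDiffAt_coordVec (hξ α)).differentiableAt (by simp)
      symm := Filter.Eventually.of_forall fun y u v => S.g.symm _ _ _
      pos := fun v hv => coordMetric_pos S.g p (mem_extChartAt_target p) hv
      sq := ?_
      orthonormal := ?_
      P_Z := ?_
      G_P_Z := ?_
      G_P_P := ?_
      dη := ?_
      dΩ := ?_
      nijenhuis := ?_ }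
  · filter_upwards [eventually_mem_target p] with y hy v
    refine hinj y hy _ _ ?_
    rw [hFP y hy, hFP y hy, map_add, map_neg, map_sum]
    simp only [map_smul, hFZ y hy, hη y hy]
    exact S.φ_sq _ _
  · filter_upwards [eventually_mem_target p] with y hy α β
    rw [hη y hy, hFZ y hy, S.η_ξ]
  · filter_upwards [eventually_mem_target p] with y hy α
    refine hinj y hy _ _ ?_
    rw [hFP y hy, hFZ y hy, S.φ_ξ, map_zero]
    rfl
  · filter_upwards [eventually_mem_target p] with y hy α v
    rw [hη y hy, hFP y hy]
    exact S.η_φ _ α _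
  · filter_upwards [eventually_mem_target p] with y hy v w
    simp only [hη y hy]
    rw [hG, hFP y hy, hFP y hy]
    exact S.g_φ _ _ _
  · intro α u v
    have key : ∀ u v, dirDeriv (constField p u) (fun x => S.η α x (constField p v x)) p =
        fderiv ℝ (fun y => coordMetric S.g p y v (coordVec (S.ξ α) p y))
          (extChartAt (𝓡 (2 * n + s)) p p) u := by
      intro u v
      have h1 := contMDiffAt_inner S.g (contMDiffAt_constField p v) (hξ α)
      simp only [← S.η_eq] at h1
      rw [dirDeriv_constField h1]
      congr 1
      refine Filter.EventuallyEq.fderiv_eq ?_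
      filter_upwards [eventually_mem_target p] with y hy
      rw [hη y hy, constField, (extChartAt (𝓡 (2 * n + s)) p).right_inv hy]
    have h1 := hS.dη_eq_zero α _ hsrc _ _ (isSmoothFieldOn_constField p u)
      (isSmoothFieldOn_constField p v) p hmem
    rw [dOne, key, key, hbr] at h1
    have h2 : S.η α p (0 : EuclideanSpace ℝ (Fin (2 * n + s))) = 0 := map_zero (S.η α p)
    rw [h2] at h1
    linarith
  · intro u v w
    have key : ∀ u v w, dirDeriv (constField p u)
        (fun x => S.fundForm x (constField p v x) (constField p w x)) p =
        fderiv ℝ (fun y => coordMetric S.g p y v (coordEndo S.φ p y w))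
          (extChartAt (𝓡 (2 * n + s)) p p) u := by
      intro u v w
      have h1 : ContMDiffAt (𝓡 (2 * n + s)) 𝓘(ℝ, ℝ) ∞
        (fun x => S.fundForm x (constField p v x) (constField p w x)) p :=
        contMDiffAt_inner S.g (contMDiffAt_constField p v) (hφc w)
      rw [dirDeriv_constField h1]
      congr 1
      refine Filter.EventuallyEq.fderiv_eq ?_
      filter_upwards [eventually_mem_target p] with y hy
      rw [hG, hFP y hy, constField, constField, (extChartAt (𝓡 (2 * n + s)) p).right_inv hy]
      rfl
    have h1 := hS.dΩ_eq_zero _ hsrc _ _ _ (isSmoothFieldOn_constField p u)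
      (isSmoothFieldOn_constField p v) (isSmoothFieldOn_constField p w) p hmem
    rw [dTwo, key, key, key, hbr, hbr, hbr] at h1
    have h2 : S.fundForm p (0 : EuclideanSpace ℝ (Fin (2 * n + s))) = 0 :=
      map_zero (S.fundForm p)
    rw [h2] at h1
    simp only [zero_apply] at h1
    linarith
  · intro u v
    have h1 := hS.normal _ hsrc _ _ (isSmoothFieldOn_constField p u)
      (isSmoothFieldOn_constField p v) p hmem
    have h2 : ∀ α, dOne (S.η α) (constField p u) (constField p v) p = 0 := fun α =>
      hS.dη_eq_zero α _ hsrc _ _ (isSmoothFieldOn_constField p u)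
        (isSmoothFieldOn_constField p v) p hmem
    simp only [h2, zero_smul, Finset.sum_const_zero, smul_zero] at h1
    rw [nijenhuis, hbr, mlieBracket_eq_lieBracket, mlieBracket_eq_lieBracket,
      mlieBracket_eq_lieBracket, (hφv u).lieBracket_vectorField_eq (hφv v),
      (hφv u).lieBracket_vectorField_eq (coordVec_constField p v),
      (coordVec_constField p u).lieBracket_vectorField_eq (hφv v),
      lieBracket_eq_of_hasFDerivAt (hPc u) (hPc v),
      lieBracket_eq_of_hasFDerivAt (hPc u) (hasFDerivAt_const v _),
      lieBracket_eq_of_hasFDerivAt (hasFDerivAt_const u _) (hPc v)] at h1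
    simp only [ContinuousLinearMap.flip_apply, zero_apply, zero_sub, sub_zero] at h1
    have key : ∀ Q : EuclideanSpace ℝ (Fin (2 * n + s)) →L[ℝ] EuclideanSpace ℝ (Fin (2 * n + s)),
        (∀ w, coordEndo S.φ p (extChartAt (𝓡 (2 * n + s)) p p) w = Q w) → ∀ a b c e,
        Q (Q 0) + (a - b) - Q (-c) - Q e = 0 →
          a - b + coordEndo S.φ p (extChartAt (𝓡 (2 * n + s)) p p) c
            - coordEndo S.φ p (extChartAt (𝓡 (2 * n + s)) p p) e = 0 := by
      intro Q hQ a b c e h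
      rw [hQ, hQ, ← h]
      simp
    exact key (S.φ p) (coordEndo_self S.φ p) _ _ _ _ h1

end CManifold

/-! ### Covariant differentiation along curves -/

section Curves

variable {d : ℕ} {M : Type*} [TopologicalSpace M]
  [ChartedSpace (EuclideanSpace ℝ (Fin d)) M] [IsManifold (𝓡 d) ∞ M]

lemma isInvertible_coordMetric
    (g : Bundle.ContMDiffRiemannianMetric (𝓡 d) ∞ (EuclideanSpace ℝ (Fin d))
      (fun p : M => TangentSpace (𝓡 d) p)) (p : M) {y : EuclideanSpace ℝ (Fin d)}
    (hy : y ∈ (extChartAt (𝓡 d) p).target) : (coordMetric g p y).IsInvertible := by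
  have hinj : Function.Injective (coordMetric g p y) := by
    refine (injective_iff_map_eq_zero _).2 fun v hv => ?_
    by_contra hne
    have h1 := coordMetric_pos g p hy hne
    rw [hv] at h1
    exact lt_irrefl _ h1
  have hfin : Module.finrank ℝ (EuclideanSpace ℝ (Fin d)) =
      Module.finrank ℝ (EuclideanSpace ℝ (Fin d) →L[ℝ] ℝ) := by
    rw [← (LinearMap.toContinuousLinearMap (𝕜 := ℝ) (E := EuclideanSpace ℝ (Fin d))
      (F' := ℝ)).finrank_eq]
    exact Subspace.dual_finrank_eq.symm
  exact ⟨(LinearEquiv.ofInjectiveOfFinrankEq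
    (coordMetric g p y : EuclideanSpace ℝ (Fin d) →ₗ[ℝ] EuclideanSpace ℝ (Fin d) →L[ℝ] ℝ)
    hinj hfin).toContinuousLinearEquiv, by ext; rfl⟩

lemma isChristoffel_christoffel
    (g : Bundle.ContMDiffRiemannianMetric (𝓡 d) ∞ (EuclideanSpace ℝ (Fin d))
      (fun p : M => TangentSpace (𝓡 d) p)) (p : M) :
    IsChristoffel (coordMetric g p) (extChartAt (𝓡 d) p p)
      (christoffel g p (extChartAt (𝓡 d) p p)) := by
  intro u v w
  rw [christoffel,
    (isInvertible_coordMetric g p (mem_extChartAt_target p)).self_apply_inverse]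
  simp [christoffelFirst]

variable {γ : ℝ → M} {J : Set ℝ}

lemma coordField_self (V : ∀ t : ℝ, TangentSpace (𝓡 d) (γ t)) (t : ℝ) :
    coordField γ V (γ t) t = V t :=
  DFunLike.congr_fun (chartDiff_self (γ t)) (V t)

/-- The covariant derivative in the chart around the point of the curve, whose differential there
is the identity. -/
lemma covDerivAlong_eq (g : Bundle.ContMDiffRiemannianMetric (𝓡 d) ∞ (EuclideanSpace ℝ (Fin d))
      (fun p : M => TangentSpace (𝓡 d) p)) {V : ∀ t : ℝ, TangentSpace (𝓡 d) (γ t)} {t : ℝ}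
    {V' : EuclideanSpace ℝ (Fin d)} (hV : HasDerivWithinAt (coordField γ V (γ t)) V' J t)
    (hJ : UniqueDiffWithinAt ℝ J t) :
    covDerivAlong g γ J V t = V' + christoffel g (γ t) (extChartAt (𝓡 d) (γ t) (γ t))
      (velocity γ J t) (V t) := by
  have : IsManifold (𝓡 d) 1 M := IsManifold.of_le (n := ∞) (by norm_cast)
  have h3 : mfderiv (𝓡 d) 𝓘(ℝ, EuclideanSpace ℝ (Fin d)) (extChartAt (𝓡 d) (γ t)) (γ t) =
    ContinuousLinearMap.id ℝ _ := mfderiv_extChartAt_self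
  rw [covDerivAlong, h3, coordField_self, coordField_self, hV.derivWithin hJ]
  exact DFunLike.congr_fun
    (ContinuousLinearMap.inverse_id (R := ℝ) (M := EuclideanSpace ℝ (Fin d))) _

lemma IsUnitSpeedCurve.uniqueDiffOn
    {g : Bundle.ContMDiffRiemannianMetric (𝓡 d) ∞ (EuclideanSpace ℝ (Fin d))
      (fun p : M => TangentSpace (𝓡 d) p)} (hγ : IsUnitSpeedCurve g γ J) : UniqueDiffOn ℝ J :=
  uniqueDiffOn_convex hγ.ordConnected.convex
    (hγ.ordConnected.convex.nontrivial_iff_nonempty_interior.1 hγ.nontrivial)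

lemma isSmoothAlong_iff (hγ : ContMDiffOn 𝓘(ℝ, ℝ) (𝓡 d) ∞ γ J)
    {V : ∀ t : ℝ, TangentSpace (𝓡 d) (γ t)} :
    IsSmoothAlong γ J V ↔ ∀ t ∈ J, ContDiffWithinAt ℝ ∞ (coordField γ V (γ t)) J t := by
  refine forall₂_congr fun t ht => ?_
  rw [Bundle.contMDiffWithinAt_totalSpace, ← contMDiffWithinAt_iff_contDiffWithinAt]
  have h1 : (fun τ => (trivializationAt (EuclideanSpace ℝ (Fin d)) (TangentSpace (𝓡 d)) (γ t)
      (⟨γ τ, V τ⟩ : TangentBundle (𝓡 d) M)).2) =ᶠ[𝓝[J] t] coordField γ V (γ t) := by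
    filter_upwards [eventually_mem_source hγ ht] with τ hτ
    exact trivializationAt_eq_chartDiff (γ t) hτ (V τ)
  rw [and_iff_right (hγ t ht)]
  exact h1.contMDiffWithinAt_iff (h1.self_of_nhdsWithin ht)

lemma hasDerivWithinAt_extChartAt_comp (hγ : ContMDiffOn 𝓘(ℝ, ℝ) (𝓡 d) ∞ γ J) {t : ℝ}
    (ht : t ∈ J) :
    HasDerivWithinAt (fun τ => extChartAt (𝓡 d) (γ t) (γ τ)) (velocity γ J t) J t := by
  have : IsManifold (𝓡 d) 1 M := IsManifold.of_le (n := ∞) (by norm_cast)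
  have h1 := ((hγ t ht).mdifferentiableWithinAt (by simp)).hasMFDerivWithinAt
  have h2 := (mdifferentiableAt_extChartAt (I := 𝓡 d) (mem_chart_source _ (γ t))).hasMFDerivAt
  have key : ∀ A : ℝ →L[ℝ] EuclideanSpace ℝ (Fin d),
      HasFDerivWithinAt (fun τ => extChartAt (𝓡 d) (γ t) (γ τ)) A J t →
      HasDerivWithinAt (fun τ => extChartAt (𝓡 d) (γ t) (γ τ)) (A 1) J t :=
    fun A hA => hA.hasDerivWithinAt
  refine (key _ (h2.comp_hasMFDerivWithinAt t h1).hasFDerivWithinAt).congr_deriv ?_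
  exact DFunLike.congr_fun (chartDiff_self (d := d) (γ t)) (velocity γ J t)

lemma isSmoothAlong_velocity (hγ : ContMDiffOn 𝓘(ℝ, ℝ) (𝓡 d) ∞ γ J) (hJ : UniqueDiffOn ℝ J) :
    IsSmoothAlong (d := d) γ J (velocity γ J) := by
  have : IsManifold (𝓡 d) (∞ + 1) M := by simpa using ‹IsManifold (𝓡 d) ∞ M›
  have h1 := hγ.contMDiffOn_tangentMapWithin (m := ∞) (by simp) hJ.uniqueMDiffOn
  have h2 : ContMDiffOn 𝓘(ℝ, ℝ) 𝓘(ℝ, ℝ).tangent ∞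
      (fun t : ℝ => (⟨t, (1 : ℝ)⟩ : TangentBundle 𝓘(ℝ, ℝ) ℝ)) J :=
    contMDiffOn_vectorSpace_iff_contDiffOn.2 contDiffOn_const
  exact h1.comp h2 fun t ht => ht

end Curves

section CManifoldCurves

variable {n s : ℕ} {M : Type*} [TopologicalSpace M]
  [ChartedSpace (EuclideanSpace ℝ (Fin (2 * n + s))) M] [IsManifold (𝓡 (2 * n + s)) ∞ M]
  {S : FramedStructure n s M} {γ : ℝ → M} {J : Set ℝ}

namespace FramedStructure

lemma isSmoothAlong_φ (S : FramedStructure n s M) (hγ : ContMDiffOn 𝓘(ℝ, ℝ) (𝓡 (2 * n + s)) ∞ γ J)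
    {V : ∀ t : ℝ, TangentSpace (𝓡 (2 * n + s)) (γ t)} (hV : IsSmoothAlong γ J V) :
    IsSmoothAlong γ J (fun t => S.φ (γ t) (V t)) := by
  intro t ht
  exact ContMDiffWithinAt.clm_bundle_apply
    ((S.φ_smooth (γ t)).comp_contMDiffWithinAt t (hγ t ht)) (hV t ht)

lemma isSmoothAlong_ξ (S : FramedStructure n s M) (hγ : ContMDiffOn 𝓘(ℝ, ℝ) (𝓡 (2 * n + s)) ∞ γ J)
    (α : Fin s) : IsSmoothAlong γ J (fun t => S.ξ α (γ t)) :=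
  (S.ξ_smooth α).comp hγ fun _ _ => Set.mem_univ _

end FramedStructure

/-- `φ` is parallel, so it commutes with covariant differentiation along curves. -/
lemma FramedStructure.IsCManifold.covDerivAlong_φ (hS : S.IsCManifold)
    (hγ : ContMDiffOn 𝓘(ℝ, ℝ) (𝓡 (2 * n + s)) ∞ γ J) (hJ : UniqueDiffOn ℝ J)
    {V : ∀ t : ℝ, TangentSpace (𝓡 (2 * n + s)) (γ t)} (hV : IsSmoothAlong γ J V) {t : ℝ}
    (ht : t ∈ J) :
    covDerivAlong S.g γ J (fun t => S.φ (γ t) (V t)) t =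
      S.φ (γ t) (covDerivAlong S.g γ J V t) := by
  have h := hS.localCStructure (γ t)
  have hΓ := isChristoffel_christoffel S.g (γ t)
  have hc := hasDerivWithinAt_extChartAt_comp hγ ht
  have hV' := (((isSmoothAlong_iff hγ).1 hV t ht).differentiableWithinAt
    (by simp)).hasDerivWithinAt
  have hP := h.diff_P.hasFDerivAt.comp_hasDerivWithinAt t hc
  have heq : coordField γ (fun t => S.φ (γ t) (V t)) (γ t) =ᶠ[𝓝[J] t]
      fun τ => (coordEndo S.φ (γ t) ∘ fun τ => extChartAt (𝓡 (2 * n + s)) (γ t) (γ τ)) τ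
        (coordField γ V (γ t) τ) := by
    filter_upwards [eventually_mem_source hγ ht] with τ hτ
    have h1 := chartFrame_chartDiff (γ t) hτ (V τ)
    simp only [Function.comp_apply]
    rw [coordEndo_apply _ _ ((extChartAt (𝓡 (2 * n + s)) (γ t)).map_source hτ),
      coordVec_extChartAt _ _ hτ, constField]
    exact congrArg (fun w => chartDiff (γ t) (γ τ) (S.φ (γ τ) w)) h1.symm
  have hd := (hP.clm_apply hV').congr_of_eventuallyEq heq (heq.self_of_nhdsWithin ht)
  rw [covDerivAlong_eq S.g hd (hJ t ht), covDerivAlong_eq S.g hV' (hJ t ht)]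
  have h2 := h.fderiv_P hΓ (velocity γ J t) (V t)
  have h3 := fun w => coordEndo_self S.φ (γ t) w
  have key : ∀ (Q : EuclideanSpace ℝ (Fin (2 * n + s)) →L[ℝ] EuclideanSpace ℝ (Fin (2 * n + s)))
      (P : EuclideanSpace ℝ (Fin (2 * n + s)) →L[ℝ] EuclideanSpace ℝ (Fin (2 * n + s)))
      (a b : EuclideanSpace ℝ (Fin (2 * n + s)))
      (G : EuclideanSpace ℝ (Fin (2 * n + s)) → EuclideanSpace ℝ (Fin (2 * n + s)))
      (v w : EuclideanSpace ℝ (Fin (2 * n + s))), (∀ w, P w = Q w) →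
      a + G (P v) = P (G v) → a + P w + G (Q v) = Q (w + G v) := by
    intro Q P a b G v w hPQ h
    rw [← hPQ, ← hPQ, map_add, ← h]
    abel
  have h4 := key (S.φ (γ t)) _ _ 0 _ (V t) (derivWithin (coordField γ V (γ t)) J t) h3 h2
  refine Eq.trans ?_ h4
  rw [coordField_self]
  rfl

/-- The fields `ξ_α` are parallel: along a curve their coordinate derivative cancels the Christoffel
term. -/
lemma FramedStructure.IsCManifold.hasDerivWithinAt_ξ (hS : S.IsCManifold)
    (hγ : ContMDiffOn 𝓘(ℝ, ℝ) (𝓡 (2 * n + s)) ∞ γ J) (α : Fin s) {t : ℝ} (ht : t ∈ J) :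
    HasDerivWithinAt (coordField γ (fun t => S.ξ α (γ t)) (γ t))
      (-christoffel S.g (γ t) (extChartAt (𝓡 (2 * n + s)) (γ t) (γ t))
        (velocity γ J t) (S.ξ α (γ t))) J t := by
  have h := hS.localCStructure (γ t)
  have hΓ := isChristoffel_christoffel S.g (γ t)
  have hc := hasDerivWithinAt_extChartAt_comp hγ ht
  have hZ := (h.diff_Z α).hasFDerivAt.comp_hasDerivWithinAt t hc
  have heq : coordField γ (fun t => S.ξ α (γ t)) (γ t) =ᶠ[𝓝[J] t]
      coordVec (S.ξ α) (γ t) ∘ fun τ => extChartAt (𝓡 (2 * n + s)) (γ t) (γ τ) := by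
    filter_upwards [eventually_mem_source hγ ht] with τ hτ
    exact (coordVec_extChartAt _ _ hτ).symm
  have hd := hZ.congr_of_eventuallyEq heq (heq.self_of_nhdsWithin ht)
  have h2 := h.fderiv_Z hΓ α (velocity γ J t)
  have h3 : coordVec (S.ξ α) (γ t) (extChartAt (𝓡 (2 * n + s)) (γ t) (γ t)) = S.ξ α (γ t) := by
    rw [coordVec_extChartAt _ _ (mem_extChartAt_source (γ t)), chartDiff_self]
    rfl
  rw [h3] at h2
  exact hd.congr_deriv (eq_neg_of_add_eq_zero_left h2)

/-- Since the `ξ_α` are parallel, only the second term of `a (∑ ξ_α - b V)` contributes to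
its covariant derivative. -/
lemma FramedStructure.IsCManifold.covDerivAlong_sum_ξ_sub (hS : S.IsCManifold)
    (hγ : ContMDiffOn 𝓘(ℝ, ℝ) (𝓡 (2 * n + s)) ∞ γ J) (hJ : UniqueDiffOn ℝ J)
    {V : ∀ t : ℝ, TangentSpace (𝓡 (2 * n + s)) (γ t)} (hV : IsSmoothAlong γ J V) (a b : ℝ)
    {t : ℝ} (ht : t ∈ J) :
    covDerivAlong S.g γ J (fun t => a • (∑ α, S.ξ α (γ t) - b • V t)) t =
      -(a * b) • covDerivAlong S.g γ J V t := by
  have h := hS.localCStructure (γ t)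
  have hΓ := isChristoffel_christoffel S.g (γ t)
  have hV' := (((isSmoothAlong_iff hγ).1 hV t ht).differentiableWithinAt
    (by simp)).hasDerivWithinAt
  have heq : coordField γ (fun t => a • (∑ α, S.ξ α (γ t) - b • V t)) (γ t) =
      fun τ => a • (∑ α, coordField γ (fun t => S.ξ α (γ t)) (γ t) τ
        - b • coordField γ V (γ t) τ) := by
    funext τ
    simp only [coordField, map_smul, map_sub, map_sum]
    rfl
  have hd := ((HasDerivWithinAt.fun_sum (u := Finset.univ) fun α _ =>
    hS.hasDerivWithinAt_ξ hγ α ht).fun_sub (hV'.fun_const_smul b)).fun_const_smul a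
  rw [← heq] at hd
  rw [covDerivAlong_eq S.g hd (hJ t ht), covDerivAlong_eq S.g hV' (hJ t ht)]
  have key : ∀ (L : EuclideanSpace ℝ (Fin (2 * n + s)) →ₗ[ℝ] EuclideanSpace ℝ (Fin (2 * n + s)))
      (z : Fin s → EuclideanSpace ℝ (Fin (2 * n + s)))
      (v w : EuclideanSpace ℝ (Fin (2 * n + s))),
      a • (∑ α, -L (z α) - b • w) + L (a • (∑ α, z α - b • v)) = -(a * b) • (w + L v) := by
    intro L z v w
    rw [map_smul, map_sub, map_sum, map_smul, Finset.sum_neg_distrib]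
    module
  exact key (h.christoffelLin hΓ (velocity γ J t)) (fun α => S.ξ α (γ t)) (V t) _

lemma isSmoothAlong_const_smul {d : ℕ} {M : Type*} [TopologicalSpace M]
    [ChartedSpace (EuclideanSpace ℝ (Fin d)) M] [IsManifold (𝓡 d) ∞ M] {γ : ℝ → M} {J : Set ℝ}
    (hγ : ContMDiffOn 𝓘(ℝ, ℝ) (𝓡 d) ∞ γ J) {V : ∀ t : ℝ, TangentSpace (𝓡 d) (γ t)}
    (hV : IsSmoothAlong γ J V) (a : ℝ) : IsSmoothAlong γ J (fun t => a • V t) := by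
  rw [isSmoothAlong_iff hγ] at hV ⊢
  intro t ht
  have heq : coordField γ (fun t => a • V t) (γ t) = fun τ => a • coordField γ V (γ t) τ := by
    funext τ
    simp only [coordField, map_smul]
    rfl
  rw [heq]
  exact (hV t ht).const_smul a

lemma covDerivAlong_const_smul {d : ℕ} {M : Type*} [TopologicalSpace M]
    [ChartedSpace (EuclideanSpace ℝ (Fin d)) M] [IsManifold (𝓡 d) ∞ M] {γ : ℝ → M} {J : Set ℝ}
    (g : Bundle.ContMDiffRiemannianMetric (𝓡 d) ∞ (EuclideanSpace ℝ (Fin d))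
      (fun p : M => TangentSpace (𝓡 d) p))
    (hγ : ContMDiffOn 𝓘(ℝ, ℝ) (𝓡 d) ∞ γ J) (hJ : UniqueDiffOn ℝ J)
    {V : ∀ t : ℝ, TangentSpace (𝓡 d) (γ t)}
    (hV : IsSmoothAlong γ J V) (a : ℝ) {t : ℝ} (ht : t ∈ J) :
    covDerivAlong g γ J (fun t => a • V t) t = a • covDerivAlong g γ J V t := by
  have hV' := (((isSmoothAlong_iff hγ).1 hV t ht).differentiableWithinAt
    (by simp)).hasDerivWithinAt
  have heq : coordField γ (fun t => a • V t) (γ t) = fun τ => a • coordField γ V (γ t) τ := by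
    funext τ
    simp only [coordField, map_smul]
    rfl
  have hd := hV'.fun_const_smul a
  rw [← heq] at hd
  rw [covDerivAlong_eq g hd (hJ t ht), covDerivAlong_eq g hV' (hJ t ht)]
  have h1 : ∀ u v : EuclideanSpace ℝ (Fin d),
      christoffel g (γ t) (extChartAt (𝓡 d) (γ t) (γ t)) u (a • v) =
        a • christoffel g (γ t) (extChartAt (𝓡 d) (γ t) (γ t)) u v := by
    intro u v
    rw [christoffel, christoffel, ← map_smul]
    congr 1
    have key : ∀ D : EuclideanSpace ℝ (Fin d) →L[ℝ] EuclideanSpace ℝ (Fin d) →L[ℝ]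
        EuclideanSpace ℝ (Fin d) →L[ℝ] ℝ,
        (1 / 2 : ℝ) • (D u (a • v) + D (a • v) u - (D.flip u).flip (a • v)) =
          a • (1 / 2 : ℝ) • (D u v + D v u - (D.flip u).flip v) := by
      intro D
      rw [(D u).map_smul, D.map_smul, (D.flip u).flip.map_smul, smul_apply]
      module
    exact key _
  exact (congrArg (a • derivWithin (coordField γ V (γ t)) J t + ·) (h1 _ _)).trans
    (smul_add _ _ _).symm

lemma FramedStructure.isSmoothAlong_sum_ξ_sub (S : FramedStructure n s M)
    (hγ : ContMDiffOn 𝓘(ℝ, ℝ) (𝓡 (2 * n + s)) ∞ γ J)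
    {V : ∀ t : ℝ, TangentSpace (𝓡 (2 * n + s)) (γ t)} (hV : IsSmoothAlong γ J V) (a b : ℝ) :
    IsSmoothAlong γ J (fun t => a • (∑ α, S.ξ α (γ t) - b • V t)) := by
  refine isSmoothAlong_const_smul hγ ?_ a
  have hξ := fun α => (isSmoothAlong_iff hγ).1 (S.isSmoothAlong_ξ hγ α)
  rw [isSmoothAlong_iff hγ] at hV ⊢
  intro t ht
  have heq : coordField γ (fun t => ∑ α, S.ξ α (γ t) - b • V t) (γ t) =
      fun τ => ∑ α, coordField γ (fun t => S.ξ α (γ t)) (γ t) τ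
        - b • coordField γ V (γ t) τ := by
    funext τ
    simp only [coordField, map_smul, map_sub, map_sum]
    rfl
  rw [heq]
  exact (ContDiffWithinAt.sum fun α _ => hξ α t ht).sub ((hV t ht).const_smul b)

end CManifoldCurves

/-! ### Magnetic curves -/

section Magnetic

variable {n s : ℕ} {M : Type*} [TopologicalSpace M]
  [ChartedSpace (EuclideanSpace ℝ (Fin (2 * n + s))) M] [IsManifold (𝓡 (2 * n + s)) ∞ M]

namespace FramedStructure

lemma inner_φ_left (S : FramedStructure n s M) (p : M) (X Y : TangentSpace (𝓡 (2 * n + s)) p) :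
    S.g.inner p (S.φ p X) Y = -S.g.inner p X (S.φ p Y) := by
  have h1 := S.g_φ p X (S.φ p Y)
  rw [S.φ_sq] at h1
  simp only [map_add, map_neg, map_sum, map_smul, S.η_φ, ← S.η_eq, smul_zero, mul_zero,
    Finset.sum_const_zero] at h1
  linarith

lemma inner_φ_self (S : FramedStructure n s M) (p : M) (X : TangentSpace (𝓡 (2 * n + s)) p) :
    S.g.inner p X (S.φ p X) = 0 := by
  have h1 := S.inner_φ_left p X X
  rw [S.g.symm] at h1
  linarith

/-- The Lorentz force of `q Ω` is `-q φ`. -/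
lemma isNormalMagneticCurve_iff (S : FramedStructure n s M) (q : ℝ) {γ : ℝ → M} {J : Set ℝ}
    (hγ : IsUnitSpeedCurve S.g γ J) :
    IsNormalMagneticCurve S.g (S.magneticField q) γ J ↔
      ∀ t ∈ J, covDerivAlong S.g γ J (velocity γ J) t = (-q) • S.φ (γ t) (velocity γ J t) := by
  have hF : ∀ p (X Y : TangentSpace (𝓡 (2 * n + s)) p),
      S.magneticField q p X Y = S.g.inner p ((-q) • S.φ p X) Y := by
    intro p X Y
    rw [map_smul, smul_apply, S.inner_φ_left, smul_eq_mul, neg_mul_neg]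
    rfl
  constructor
  · rintro ⟨-, Φ, hΦ, h⟩ t ht
    rw [h t ht]
    by_contra hne
    have h1 := S.g.pos (γ t) _ (sub_ne_zero.2 hne)
    rw [(S.g.inner (γ t)).map_sub, sub_apply, hΦ, hF, sub_self] at h1
    exact lt_irrefl _ h1
  · intro h
    exact ⟨hγ, fun p => (-q) • S.φ p, fun p X Y => (hF p X Y).symm, h⟩

variable {p : M} {c : ℝ} {T : TangentSpace (𝓡 (2 * n + s)) p}

/-- For a unit vector `T` with `η^α(T) = c` for all `α`. -/
lemma inner_φ_φ_slant (S : FramedStructure n s M) (hT : S.g.inner p T T = 1)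
    (hc : ∀ α, S.η α p T = c) : S.g.inner p (S.φ p T) (S.φ p T) = 1 - s * c ^ 2 := by
  rw [S.g_φ, hT]
  simp [hc, sq]

lemma φ_φ_slant (S : FramedStructure n s M) (hc : ∀ α, S.η α p T = c) :
    S.φ p (S.φ p T) = -T + c • ∑ α, S.ξ α p := by
  rw [S.φ_sq, Finset.smul_sum]
  simp only [hc]

lemma inner_sum_ξ (S : FramedStructure n s M) (hc : ∀ α, S.η α p T = c) :
    S.g.inner p T (∑ α, S.ξ α p) = s * c := by
  rw [map_sum]
  simp [← S.η_eq, hc]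

lemma inner_sum_ξ_sum_ξ (S : FramedStructure n s M) (p : M) :
    S.g.inner p (∑ α, S.ξ α p) (∑ α, S.ξ α p) = s := by
  rw [map_sum, map_sum]
  simp [← S.η_eq, S.η_ξ]

lemma eq_smul_sum_ξ_of_slant (S : FramedStructure n s M) (hT : S.g.inner p T T = 1)
    (hc : ∀ α, S.η α p T = c) (h : 1 - s * c ^ 2 = 0) :
    S.φ p T = 0 ∧ T = c • ∑ α, S.ξ α p := by
  have h1 : S.φ p T = 0 := by
    by_contra hne
    have h2 := S.g.pos p _ hne
    rw [S.inner_φ_φ_slant hT hc, h] at h2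
    exact lt_irrefl _ h2
  refine ⟨h1, ?_⟩
  have h2 := S.φ_φ_slant hc
  rw [h1, map_zero] at h2
  exact (neg_add_eq_zero.1 h2.symm)

lemma slant_nonneg (S : FramedStructure n s M) (hT : S.g.inner p T T = 1)
    (hc : ∀ α, S.η α p T = c) : 0 ≤ 1 - s * c ^ 2 := by
  rw [← S.inner_φ_φ_slant hT hc]
  by_cases h : S.φ p T = 0
  · rw [h, map_zero]
  · exact (S.g.pos p _ h).le

/-- The orthonormality relations of the three fields of the helix frame. -/
lemma inner_frame (S : FramedStructure n s M) (hT : S.g.inner p T T = 1)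
    (hc : ∀ α, S.η α p T = c) :
    S.g.inner p (S.φ p T) (∑ α, S.ξ α p - (s * c) • T) = 0 ∧
    S.g.inner p T (∑ α, S.ξ α p - (s * c) • T) = 0 ∧
    S.g.inner p (∑ α, S.ξ α p - (s * c) • T) (∑ α, S.ξ α p - (s * c) • T)
      = s * (1 - s * c ^ 2) := by
  have h1 : S.g.inner p T (∑ α, S.ξ α p - (s * c) • T) = 0 := by
    rw [map_sub, S.inner_sum_ξ hc, map_smul, hT, smul_eq_mul]
    ring
  refine ⟨?_, h1, ?_⟩
  · rw [map_sub, map_smul, S.inner_φ_left p T T, S.inner_φ_self,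
      S.inner_sum_ξ (T := S.φ p T) (c := 0) (fun α => S.η_φ p α T)]
    simp
  · rw [(S.g.inner p).map_sub, (S.g.inner p).map_smul, sub_apply, smul_apply, h1, map_sub,
      map_smul, S.inner_sum_ξ_sum_ξ, S.g.symm p _ T, S.inner_sum_ξ hc]
    simp only [smul_eq_mul]
    ring

end FramedStructure

end Magnetic

/-- The Frenet equations of a circle. -/
lemma isCircle_iff {d : ℕ} {M : Type*} [TopologicalSpace M]
    [ChartedSpace (EuclideanSpace ℝ (Fin d)) M] [IsManifold (𝓡 d) ∞ M]
    (g : Bundle.ContMDiffRiemannianMetric (𝓡 d) ∞ (EuclideanSpace ℝ (Fin d))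
      (fun p : M => TangentSpace (𝓡 d) p)) (γ : ℝ → M) (J : Set ℝ) (κ₁ : ℝ)
    (v₂ : ∀ t : ℝ, TangentSpace (𝓡 d) (γ t)) (hJ : J.Nonempty) :
    IsCircle g γ J κ₁ v₂ ↔ IsSmoothAlong (d := d) γ J (velocity γ J) ∧ IsSmoothAlong γ J v₂ ∧ 0 < κ₁ ∧
      ∀ t ∈ J, (g.inner (γ t) (velocity γ J t) (velocity γ J t) = 1 ∧
        g.inner (γ t) (v₂ t) (v₂ t) = 1 ∧ g.inner (γ t) (velocity γ J t) (v₂ t) = 0) ∧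
        covDerivAlong g γ J (velocity γ J) t = κ₁ • v₂ t ∧
        covDerivAlong g γ J v₂ t = -(κ₁ • velocity γ J t) := by
  constructor
  · intro h
    refine ⟨h.smooth 0, h.smooth 1, h.curvature_pos 0 _ hJ.some_mem, fun t ht =>
      ⟨⟨h.orthonormal t ht 0 0, h.orthonormal t ht 1 1, h.orthonormal t ht 0 1⟩, ?_, ?_⟩⟩
    · simpa using h.frenet t ht 0
    · simpa using h.frenet t ht 1
  · rintro ⟨h1, h2, h3, h4⟩
    refine ⟨fun t ht => rfl, ?_, ?_, ?_, ?_⟩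
    · intro i
      fin_cases i
      · exact h1
      · exact h2
    · intro t ht i j
      obtain ⟨⟨h5, h6, h7⟩, -⟩ := h4 t ht
      fin_cases i <;> fin_cases j
      · exact h5
      · exact h7
      · exact (g.symm _ _ _).trans h7
      · exact h6
    · intro i t ht
      fin_cases i
      exact h3
    · intro t ht i
      obtain ⟨-, h5, h6⟩ := h4 t ht
      match i with
      | 0 => simpa using h5
      | 1 => simpa using h6

/-- The right-hand sides of the Frenet equations of order three. -/
lemma frenet_sum_two {V : Type*} [AddCommGroup V] [Module ℝ V] (κ : Fin 2 → ℝ) (v : Fin 3 → V)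
    (i : Fin 3) :
    (∑ j : Fin 2, if j.castSucc = i then κ j • v j.succ else 0)
      - (∑ j : Fin 2, if j.succ = i then κ j • v j.castSucc else 0) =
    ![κ 0 • v 1, κ 1 • v 2 - κ 0 • v 0, -(κ 1 • v 1)] i := by
  rw [Fin.sum_univ_two, Fin.sum_univ_two]
  match i with
  | 0 => exact (by simp : κ 0 • v 1 + 0 - (0 + 0) = κ 0 • v 1)
  | 1 => exact (by simp : 0 + κ 1 • v 2 - (κ 0 • v 0 + 0) = κ 1 • v 2 - κ 0 • v 0)
  | 2 => exact (by simp : 0 + 0 - (0 + κ 1 • v 1) = -(κ 1 • v 1))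

lemma frenet_two_iff {d : ℕ} {M : Type*} [TopologicalSpace M]
    [ChartedSpace (EuclideanSpace ℝ (Fin d)) M] [IsManifold (𝓡 d) ∞ M]
    (g : Bundle.ContMDiffRiemannianMetric (𝓡 d) ∞ (EuclideanSpace ℝ (Fin d))
      (fun p : M => TangentSpace (𝓡 d) p)) (γ : ℝ → M) (J : Set ℝ)
    (v : Fin 3 → ∀ t : ℝ, TangentSpace (𝓡 d) (γ t)) (κ : Fin 2 → ℝ → ℝ) (t : ℝ) :
    (∀ i, covDerivAlong g γ J (v i) t =
      (∑ j : Fin 2, if j.castSucc = i then κ j t • v j.succ t else 0)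
        - ∑ j : Fin 2, if j.succ = i then κ j t • v j.castSucc t else 0) ↔
    covDerivAlong g γ J (v 0) t = κ 0 t • v 1 t ∧
    covDerivAlong g γ J (v 1) t = κ 1 t • v 2 t - κ 0 t • v 0 t ∧
    covDerivAlong g γ J (v 2) t = -(κ 1 t • v 1 t) := by
  have key := frenet_sum_two (fun j => κ j t) (fun j => v j t)
  constructor
  · intro h
    exact ⟨(h 0).trans (key 0), (h 1).trans (key 1), (h 2).trans (key 2)⟩
  · rintro ⟨h0, h1, h2⟩ i
    match i with
    | 0 => exact h0.trans (key 0).symm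
    | 1 => exact h1.trans (key 1).symm
    | 2 => exact h2.trans (key 2).symm

/-- The Frenet equations of a helix. -/
lemma isHelix_iff {d : ℕ} {M : Type*} [TopologicalSpace M]
    [ChartedSpace (EuclideanSpace ℝ (Fin d)) M] [IsManifold (𝓡 d) ∞ M]
    (g : Bundle.ContMDiffRiemannianMetric (𝓡 d) ∞ (EuclideanSpace ℝ (Fin d))
      (fun p : M => TangentSpace (𝓡 d) p)) (γ : ℝ → M) (J : Set ℝ) (κ₁ κ₂ : ℝ)
    (v₂ v₃ : ∀ t : ℝ, TangentSpace (𝓡 d) (γ t)) (hJ : J.Nonempty) :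
    IsHelix g γ J κ₁ κ₂ v₂ v₃ ↔ IsSmoothAlong (d := d) γ J (velocity γ J) ∧ IsSmoothAlong γ J v₂ ∧
      IsSmoothAlong γ J v₃ ∧ 0 < κ₁ ∧ 0 < κ₂ ∧
      ∀ t ∈ J, (g.inner (γ t) (velocity γ J t) (velocity γ J t) = 1 ∧
        g.inner (γ t) (v₂ t) (v₂ t) = 1 ∧ g.inner (γ t) (v₃ t) (v₃ t) = 1 ∧
        g.inner (γ t) (velocity γ J t) (v₂ t) = 0 ∧ g.inner (γ t) (velocity γ J t) (v₃ t) = 0 ∧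
        g.inner (γ t) (v₂ t) (v₃ t) = 0) ∧
        covDerivAlong g γ J (velocity γ J) t = κ₁ • v₂ t ∧
        covDerivAlong g γ J v₂ t = κ₂ • v₃ t - κ₁ • velocity γ J t ∧
        covDerivAlong g γ J v₃ t = -(κ₂ • v₂ t) := by
  constructor
  · intro h
    refine ⟨h.smooth 0, h.smooth 1, h.smooth 2, h.curvature_pos 0 _ hJ.some_mem,
      h.curvature_pos 1 _ hJ.some_mem, fun t ht =>
      ⟨⟨h.orthonormal t ht 0 0, h.orthonormal t ht 1 1, h.orthonormal t ht 2 2,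
        h.orthonormal t ht 0 1, h.orthonormal t ht 0 2, h.orthonormal t ht 1 2⟩,
        (frenet_two_iff g γ J _ _ t).1 (h.frenet t ht)⟩⟩
  · rintro ⟨h1, h2, h3, k1, k2, h4⟩
    refine ⟨fun t ht => rfl, ?_, ?_, ?_, ?_⟩
    · intro i
      fin_cases i
      · exact h1
      · exact h2
      · exact h3
    · intro t ht i j
      obtain ⟨⟨h5, h6, h7, h8, h9, h10⟩, -⟩ := h4 t ht
      fin_cases i <;> fin_cases j
      · exact h5
      · exact h8
      · exact h9
      · exact (g.symm _ _ _).trans h8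
      · exact h6
      · exact h10
      · exact (g.symm _ _ _).trans h9
      · exact (g.symm _ _ _).trans h10
      · exact h7
    · intro i t ht
      fin_cases i
      · exact k1
      · exact k2
    · exact fun t ht => (frenet_two_iff g γ J ![velocity γ J, v₂, v₃]
        ![fun _ => κ₁, fun _ => κ₂] t).2 (h4 t ht).2

lemma realSign_mul_realSign {x : ℝ} (hx : x ≠ 0) : Real.sign x * Real.sign x = 1 := by
  rcases Real.sign_apply_eq_of_ne_zero x hx with h | h <;> rw [h] <;> norm_num

lemma realSign_mul_self (x : ℝ) : Real.sign x * x = |x| := by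
  rcases lt_trichotomy x 0 with h | rfl | h
  · rw [Real.sign_of_neg h, abs_of_neg h, neg_one_mul]
  · simp
  · rw [Real.sign_of_pos h, abs_of_pos h, one_mul]

lemma abs_mul_realSign {x : ℝ} (hx : x ≠ 0) : |x| * Real.sign x = x := by
  rw [← realSign_mul_self]
  linear_combination x * realSign_mul_realSign hx

section Classification

variable {n s : ℕ} {M : Type*} [TopologicalSpace M]
  [ChartedSpace (EuclideanSpace ℝ (Fin (2 * n + s))) M] [IsManifold (𝓡 (2 * n + s)) ∞ M]
  {S : FramedStructure n s M} {γ : ℝ → M} {J : Set ℝ} {q : ℝ} {c : ℝ}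

namespace FramedStructure.IsCManifold

/-- The second Frenet equation of a magnetic curve, up to normalization: since `φ` is parallel,
differentiating `φ T` leads to `φ² T`. -/
lemma covDerivAlong_smul_φ_velocity (hS : S.IsCManifold) (hγ : IsUnitSpeedCurve S.g γ J)
    (hc : ∀ α, ∀ t ∈ J, S.η α (γ t) (velocity γ J t) = c)
    (hmag : ∀ t ∈ J, covDerivAlong S.g γ J (velocity γ J) t =
      (-q) • S.φ (γ t) (velocity γ J t)) (a : ℝ) {t : ℝ} (ht : t ∈ J) :
    covDerivAlong S.g γ J (fun t => a • S.φ (γ t) (velocity γ J t)) t =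
      (a * q) • (velocity γ J t - c • ∑ α, S.ξ α (γ t)) := by
  have hJ := hγ.uniqueDiffOn
  have hT := isSmoothAlong_velocity hγ.smooth hJ
  rw [covDerivAlong_const_smul S.g hγ.smooth hJ (S.isSmoothAlong_φ hγ.smooth hT) a ht,
    hS.covDerivAlong_φ hγ.smooth hJ hT ht, hmag t ht, map_smul,
    S.φ_φ_slant fun α => hc α t ht]
  module

lemma isCircle_of_magnetic (hS : S.IsCManifold) (hq : q ≠ 0) (hγ : IsUnitSpeedCurve S.g γ J)
    (hc : ∀ α, ∀ t ∈ J, S.η α (γ t) (velocity γ J t) = 0)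
    (hmag : ∀ t ∈ J, covDerivAlong S.g γ J (velocity γ J) t =
      (-q) • S.φ (γ t) (velocity γ J t)) :
    IsCircle S.g γ J |q| (fun t => (-Real.sign q) • S.φ (γ t) (velocity γ J t)) := by
  have hJ := hγ.uniqueDiffOn
  have hT := isSmoothAlong_velocity hγ.smooth hJ
  have hsq := realSign_mul_realSign hq
  have habs' := realSign_mul_self q
  have habs := abs_mul_realSign hq
  rw [isCircle_iff _ _ _ _ _ hγ.nontrivial.nonempty]
  refine ⟨hT, isSmoothAlong_const_smul hγ.smooth (S.isSmoothAlong_φ hγ.smooth hT) _,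
    abs_pos.2 hq, fun t ht => ⟨⟨hγ.unit t ht, ?_, ?_⟩, ?_, ?_⟩⟩
  · rw [(S.g.inner (γ t)).map_smul, map_smul, smul_apply,
      S.inner_φ_φ_slant (hγ.unit t ht) fun α => hc α t ht]
    simp only [smul_eq_mul]
    linear_combination hsq
  · rw [map_smul, S.inner_φ_self, smul_zero]
  · rw [hmag t ht, smul_smul]
    congr 1
    linear_combination habs
  · rw [hS.covDerivAlong_smul_φ_velocity hγ hc hmag _ ht, ← neg_smul, zero_smul, sub_zero]
    congr 1
    linear_combination -habs'

lemma isHelix_of_magnetic (hS : S.IsCManifold) (hs : 1 ≤ s) (hq : q ≠ 0)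
    (hγ : IsUnitSpeedCurve S.g γ J) (hc0 : c ≠ 0) (hpos : 0 < 1 - s * c ^ 2)
    (hc : ∀ α, ∀ t ∈ J, S.η α (γ t) (velocity γ J t) = c)
    (hmag : ∀ t ∈ J, covDerivAlong S.g γ J (velocity γ J) t =
      (-q) • S.φ (γ t) (velocity γ J t)) :
    IsHelix S.g γ J
      (|q| * √(1 - s * c ^ 2))
      (|q| * √(s : ℝ) * Real.sign c * c)
      (fun t => (-Real.sign q / √(1 - s * c ^ 2)) • S.φ (γ t) (velocity γ J t))
      (fun t => (Real.sign c / (√(s : ℝ) * √(1 - s * c ^ 2))) •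
        (∑ α, S.ξ α (γ t) - (s * c) • velocity γ J t)) := by
  have hJ := hγ.uniqueDiffOn
  have hT := isSmoothAlong_velocity hγ.smooth hJ
  have hq1 := realSign_mul_realSign hq
  have hq2 := realSign_mul_self q
  have hc1 := realSign_mul_realSign hc0
  have hc2 := realSign_mul_self c
  have hs0 : (0 : ℝ) < s := by exact_mod_cast hs
  set r := √(1 - s * c ^ 2) with hr
  set w := √(s : ℝ) with hw
  have hr0 : 0 < r := Real.sqrt_pos.2 hpos
  have hw0 : 0 < w := Real.sqrt_pos.2 hs0
  have hr2 : r ^ 2 = 1 - s * c ^ 2 := Real.sq_sqrt hpos.le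
  have hw2 : w ^ 2 = s := Real.sq_sqrt hs0.le
  have hqq := abs_mul_realSign hq
  rw [isHelix_iff _ _ _ _ _ _ _ hγ.nontrivial.nonempty]
  refine ⟨hT, isSmoothAlong_const_smul hγ.smooth (S.isSmoothAlong_φ hγ.smooth hT) _,
    S.isSmoothAlong_sum_ξ_sub hγ.smooth hT _ _, mul_pos (abs_pos.2 hq) hr0, ?_, fun t ht => ?_⟩
  · rw [mul_assoc, hc2]
    exact mul_pos (mul_pos (abs_pos.2 hq) hw0) (abs_pos.2 hc0)
  have hct := fun α => hc α t ht
  obtain ⟨h1, h2, h3⟩ := S.inner_frame (hγ.unit t ht) hct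
  refine ⟨⟨hγ.unit t ht, ?_, ?_, ?_, ?_, ?_⟩, ?_, ?_, ?_⟩
  · rw [(S.g.inner (γ t)).map_smul, map_smul, smul_apply,
      S.inner_φ_φ_slant (hγ.unit t ht) hct, ← hr2]
    simp only [smul_eq_mul]
    field_simp
    linear_combination hq1
  · rw [(S.g.inner (γ t)).map_smul, map_smul, smul_apply, h3, ← hr2, ← hw2]
    simp only [smul_eq_mul]
    field_simp
    linear_combination hc1
  · rw [map_smul, S.inner_φ_self, smul_zero]
  · rw [map_smul, h2, smul_zero]
  · rw [(S.g.inner (γ t)).map_smul, map_smul, smul_apply, h1, smul_zero, smul_zero]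
  · rw [hmag t ht, smul_smul]
    congr 1
    field_simp
    linear_combination hqq
  · rw [hS.covDerivAlong_smul_φ_velocity hγ hc hmag _ ht]
    -- compare the coefficients of `∑ ξ_α` and of `T`
    have e1 : -Real.sign q / r * q * c = -(|q| * w * Real.sign c * c *
        (Real.sign c / (w * r))) := by
      field_simp
      linear_combination -hq2 + |q| * hc1
    have e2 : -Real.sign q / r * q = -(|q| * w * Real.sign c * c *
        (Real.sign c / (w * r)) * (s * c)) - |q| * r := by
      field_simp
      linear_combination -hq2 + |q| * hr2 + |q| * s * c ^ 2 * hc1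
    rw [smul_sub, smul_smul, e1, e2]
    module
  · rw [hS.covDerivAlong_sum_ξ_sub hγ.smooth hJ hT _ _ ht, hmag t ht, smul_smul, smul_smul,
      ← neg_smul]
    congr 1
    field_simp
    rw [hw2]
    linear_combination -Real.sign c * s * hqq

end FramedStructure.IsCManifold

end Classification

end CMagnetic

end

open CMagnetic in
theorem corollary1 {n s : ℕ} (hs : 1 ≤ s) {M : Type*} [TopologicalSpace M]
    [ChartedSpace (EuclideanSpace ℝ (Fin (2 * n + s))) M]
    [IsManifold (𝓡 (2 * n + s)) ∞ M]
    (S : FramedStructure n s M) (hS : S.IsCManifold) (q : ℝ) (hq : q ≠ 0)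
    (γ : ℝ → M) (J : Set ℝ) (hγ : IsUnitSpeedCurve S.g γ J)
    (θ : ℝ) (hθ : S.IsSlant γ J θ) :
    IsNormalMagneticCurve S.g (S.magneticField q) γ J ↔
      (IsGeodesic S.g γ J ∧
        ((∀ t ∈ J, velocity γ J t = (1 / √(s : ℝ)) • ∑ α, S.ξ α (γ t)) ∨
         (∀ t ∈ J, velocity γ J t = (-1 / √(s : ℝ)) • ∑ α, S.ξ α (γ t)))) ∨
      (S.IsLegendre γ J ∧
        IsCircle S.g γ J |q| (fun t => (-Real.sign q) • S.φ (γ t) (velocity γ J t))) ∨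
      (¬ S.IsLegendre γ J ∧ θ ≠ Real.pi / 2 ∧ |Real.cos θ| < 1 / √(s : ℝ) ∧
        IsHelix S.g γ J
          (|q| * √(1 - s * Real.cos θ ^ 2))
          (|q| * √(s : ℝ) * Real.sign (Real.cos θ) * Real.cos θ)
          (fun t => (-Real.sign q / √(1 - s * Real.cos θ ^ 2)) • S.φ (γ t) (velocity γ J t))
          (fun t => (Real.sign (Real.cos θ) / (√(s : ℝ) * √(1 - s * Real.cos θ ^ 2))) •
            (∑ α, S.ξ α (γ t) - (s * Real.cos θ) • velocity γ J t))) := by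
  have hs0 : (0 : ℝ) < s := by exact_mod_cast hs
  have hw0 : 0 < √(s : ℝ) := Real.sqrt_pos.2 hs0
  have hw2 : √(s : ℝ) ^ 2 = s := Real.sq_sqrt hs0.le
  have hne := hγ.nontrivial.nonempty
  have habs := abs_mul_realSign hq
  rw [S.isNormalMagneticCurve_iff q hγ]
  constructor
  · intro hmag
    obtain ⟨t₀, ht₀⟩ := hne
    rcases (S.slant_nonneg (hγ.unit t₀ ht₀) fun α => hθ α t₀ ht₀).eq_or_lt' with h0 | hpos
    · -- `T` is a combination of the `ξ_α`: `φ T = 0` and `cos θ = ± 1 / √s`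
      left
      have hT := fun t (ht : t ∈ J) =>
        S.eq_smul_sum_ξ_of_slant (hγ.unit t ht) (fun α => hθ α t ht) h0
      refine ⟨fun t ht => by rw [hmag t ht, (hT t ht).1, smul_zero], ?_⟩
      have h1 : (Real.cos θ * √(s : ℝ) - 1) * (Real.cos θ * √(s : ℝ) + 1) = 0 := by
        linear_combination Real.cos θ ^ 2 * hw2 - h0
      rcases mul_eq_zero.1 h1 with h2 | h2
      · left
        intro t ht
        rw [← (eq_div_iff hw0.ne').2 (sub_eq_zero.1 h2)]
        exact (hT t ht).2
      · right
        intro t ht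
        rw [← (eq_div_iff hw0.ne').2 (eq_neg_of_add_eq_zero_left h2)]
        exact (hT t ht).2
    · right
      by_cases hc : Real.cos θ = 0
      · left
        have hL : S.IsLegendre γ J := fun α t ht => (hθ α t ht).trans hc
        exact ⟨hL, hS.isCircle_of_magnetic hq hγ hL hmag⟩
      · right
        refine ⟨fun hL => hc ?_, fun h => hc ?_, ?_,
          hS.isHelix_of_magnetic hs hq hγ hc hpos hθ hmag⟩
        · exact (hθ ⟨0, hs⟩ t₀ ht₀).symm.trans (hL _ t₀ ht₀)
        · rw [h, Real.cos_pi_div_two]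
        · rw [lt_div_iff₀ hw0, ← abs_of_pos hw0, ← abs_mul]
          refine (sq_lt_one_iff_abs_lt_one _).1 ?_
          rw [mul_pow, hw2]
          linarith
  · rintro (⟨hgeo, h⟩ | ⟨hL, h⟩ | ⟨-, -, -, h⟩) t ht
    · have hφ : S.φ (γ t) (∑ α, S.ξ α (γ t)) = 0 := by
        rw [map_sum]
        simp [S.φ_ξ]
      rw [hgeo t ht]
      rcases h with h | h <;> rw [h t ht, map_smul, hφ, smul_zero, smul_zero]
    · rw [isCircle_iff _ _ _ _ _ hne] at h
      rw [(h.2.2.2 t ht).2.1, smul_smul]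
      congr 1
      linear_combination -habs
    · rw [isHelix_iff _ _ _ _ _ _ _ hne] at h
      obtain ⟨-, -, -, hκ, -, h⟩ := h
      have hr : √(1 - s * Real.cos θ ^ 2) ≠ 0 := (pos_of_mul_pos_right hκ (abs_nonneg q)).ne'
      rw [(h t ht).2.1, smul_smul]
      congr 1
      field_simp
      linear_combination -habs
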